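/- **Setting.** A plant $\dot x_p=f_p(x_p,\hat u)$, $x_p\in\mathbb R^{n_p}$, and a controller $\dot x_c=f_c(x_c,\hat x_p)$, $u=g_c(x_c,x_p)$, $x_c\in\mathbb R^{n_c}$, are sampled with zero-order hold at instants $t_0=0\le t_1\le\dots$. With $x=(x_p,x_c)$, $e=(\hat x_p-x_p,\hat x_c-x_c)$ and $$f(x,e)=\bigl(f_p(x_p,g_c(x_c+e_{x_c},x_p+e_{x_p})),\ f_c(x_c,x_p+e_{x_p})\bigr),\qquad g=-f,$$ assumed continuous in $(x,e)$, the closed loop is the hybrid system in $\xi=(x,e,\eta,\tau,\bar h)$ with $$\dot\xi=(f(x,e),g(x,e),0,1,0)\ \text{ on } \{\tau\le\bar h\},\qquad \xi^+=(x,0,S(\eta,x),0,\Gamma(x,\eta))\ \text{ on } \{\tau=\bar h\}.$$ Solutions are hybrid trajectories $\xi(t,j)$ on hybrid time domains, absolutely continuous in $t$ on compact intervals; initial values satisfy $\bar h(0,0)=\tau(0,0)\ge 0$. The sampling instant $t_j$ is the time at which $\xi$ jumps from $(t_j,j)$ to $(t_j,j+1)$. **Assumption A** (for sets $\mathcal X,\mathcal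 E$, a function $V$ and $\epsilon\in\mathbb R$, $\gamma,L>0$). $V\ge 0$ is locally Lipschitz on $\mathcal X$, and there are a locally Lipschitz $W:\mathcal E\to\mathbb R_{\ge0}$, a continuous $H:\mathcal X\times\mathcal E\to\mathbb R_{\ge0}$ and $\underline\alpha_W,\overline\alpha_W,\underline\alpha_V,\overline\alpha_V\in\mathcal K_\infty$ with $\underline\alpha_W(\|e\|)\le W(e)\le\overline\alpha_W(\|e\|)$ on $\mathcal E$, $\underline\alpha_V(\|x\|)\le V(x)\le\overline\alpha_V(\|x\|)$ on $\mathcal X$; for all $x\in\mathcal X$ and almost all $e\in\mathcal E$, $\langle\nabla W(e),g(x,e)\rangle\le LW(e)+H(x,e)$; and for all $e\in\mathcal E$ and almost all $x\in\mathcal X$, $\langle\nabla V(x),f(x,e)\rangle\le-\epsilon V(x)-H(x,e)^2+\gamma^2W(e)^2$ (the last two wherever the gradient exists). **Mechanism.** Let $m\ge1$, $\delta\in(0,1)$, $\epsilon_{\rm ref}>0$, $c>0$, $\eta\in\mathbb R^{m-1}$, and $$S(\eta,x)=(\eta_2,\dots,\eta_{m-1},V(x)),\qquad C(x,\eta)=\min\Bigl\{c,\tfrac1m\Bigl(V(x)+\sum_{k=1}^{m-1}\eta_k\Bigr)\Bigr\}.$$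 For $\gamma,\Lambda>0$ put $r=\sqrt{|(\gamma/\Lambda)^2-1|}$ and let $T_{\max}(\gamma,\Lambda)$ be $\frac{\arctan r}{\Lambda r}$ if $\gamma>\Lambda$, $\frac1\Lambda$ if $\gamma=\Lambda$, and $\frac{\operatorname{arctanh}r}{\Lambda r}$ if $\gamma<\Lambda$. Given parameter sets $(\epsilon_i,\gamma_i,L_i)$, $1\le i\le n_p^{\ast}$ (with $n_p^{\ast}\ge 1$), let $T_i=\delta T_{\max}(\gamma_i,\max\{L_i+\frac{\epsilon_i}2,1-\delta\})$, $d_i=-\epsilon_i+\epsilon_{\rm ref}$, and define $\bar h_i$ for $i\ge2$ by: - if $C\ge V(x)$: $\bar h_i=\min\{T_i,(\log C-\log V(x))/d_i\}$ when $d_i>0$ (read as $T_i$ when $V(x)=0$), and $\bar h_i=T_i$ when $d_i\le0$; - if $C<V(x)$: $\bar h_i=T_i$ when $d_i<0$, $C>0$ and $(\log C-\log V(x))/d_i<T_i$; otherwise $\bar h_i=0$. $\Gamma(x,\eta)$ is the maximum of $\delta T_{\max}(\gamma_1,L_1+\frac{\epsilon_1}2)$ and the $\bar h_i$, $i\ge2$.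 **Theorem.** Let $V:\mathbb R^{n_p+n_c}\to\mathbb R$ be continuous, $c>0$, $\mathcal R=\{x: V(x)\le c\}\subseteq\mathcal X$ and $\{\hat x-x:\hat x,x\in\mathcal R\}\subseteq\mathcal E$, and let every $x$ with $V(x)=c$ be an interior point of $\mathcal X$ or a limit of points $y$ with $V(y)<c$. Suppose Assumption A holds with this $V,\mathcal X,\mathcal E$ for each $(\epsilon_i,\gamma_i,L_i)$, $1\le i\le n_p^{\ast}$ ($W$, $H$ and the $\mathcal K_\infty$ functions may depend on $i$), and that $\epsilon_1>0$. Then $t_{\min}:=\delta T_{\max}(\gamma_1,L_1+\frac{\epsilon_1}2)>0$, $t_{j+1}-t_j\ge t_{\min}$ for all $j\in\mathbb N_0$ for which these instants exist, along every solution, and the set $\{x=0,e=0,\eta=0\}$ is asymptotically stable with region of attraction $\mathcal R$: there is $\beta\in\mathcal{KLL}$ such that every solution with $x(0,0)\in\mathcal R$, $e(0,0)$, $\eta(0,0)$ arbitrary and $\bar h(0,0)=\tau(0,0)\ge0$ satisfies $$\|(x,e,\eta)(t,j)\|\le\beta\bigl(\|(x,e,\eta)(0,0)\|,t,j\bigr)$$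 for all $(t,j)$ in its domain. Here $\beta\in\mathcal{KLL}$ means that $\beta(\cdot,r,\cdot)$ and $\beta(\cdot,\cdot,r)$ are of class $\mathcal{KL}$ for each $r\ge0$. -/

import Mathlib

open MeasureTheory Filter Topology
open scoped NNReal

noncomputable section

namespace DynSTC

/-! ### Comparison functions -/

/-- Class `𝒦`: continuous, strictly increasing, zero at zero. -/
structure ClassK (α : ℝ≥0 → ℝ≥0) : Prop where
  continuous : Continuous α
  strictMono : StrictMono α
  map_zero : α 0 = 0

/-- Class `𝒦_∞`: class `𝒦` and unbounded. -/
structure ClassKInf (α : ℝ≥0 → ℝ≥0) : Prop extends ClassK α where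
  unbounded : ∀ M : ℝ≥0, ∃ s : ℝ≥0, M < α s

/-- Class `𝒦ℒ`. -/
structure ClassKL (β : ℝ≥0 → ℝ≥0 → ℝ≥0) : Prop where
  continuous : Continuous (fun p : ℝ≥0 × ℝ≥0 => β p.1 p.2)
  classK : ∀ t : ℝ≥0, ClassK (fun q => β q t)
  antitone : ∀ q : ℝ≥0, Antitone (β q)
  tendsto_zero : ∀ q : ℝ≥0, Tendsto (β q) atTop (𝓝 0)

/-- Class `𝒦ℒℒ`. -/
structure ClassKLL (β : ℝ≥0 → ℝ≥0 → ℝ≥0 → ℝ≥0) : Prop where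
  left : ∀ r : ℝ≥0, ClassKL (fun q t => β q r t)
  right : ∀ r : ℝ≥0, ClassKL (fun q t => β q t r)

/-! ### Hybrid systems and their solutions -/

/-- A compact hybrid time domain: `⋃_{j < J} [t_j, t_{j+1}] × {j}` with
`0 = t_0 ≤ t_1 ≤ ⋯ ≤ t_J`. -/
def IsCompactHybridTimeDomain (E : Set (ℝ × ℕ)) : Prop :=
  ∃ (J : ℕ) (t : ℕ → ℝ), t 0 = 0 ∧ (∀ j < J, t j ≤ t (j + 1)) ∧
    E = {p | p.2 < J ∧ t p.2 ≤ p.1 ∧ p.1 ≤ t (p.2 + 1)}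

/-- A (nonempty) hybrid time domain: a subset of `[0, ∞) × ℕ₀` all of whose truncations
`E ∩ ([0, T] × {0, …, J})` with `(T, J) ∈ E` are compact hybrid time domains. -/
structure IsHybridTimeDomain (E : Set (ℝ × ℕ)) : Prop where
  nonempty : E.Nonempty
  nonneg : ∀ p ∈ E, 0 ≤ p.1
  truncation : ∀ p ∈ E,
    IsCompactHybridTimeDomain (E ∩ {q | 0 ≤ q.1 ∧ q.1 ≤ p.1 ∧ q.2 ≤ p.2})

/-- The data `ξ' = F ξ` on `C`, `ξ⁺ = G ξ` on `D` of a hybrid system. -/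
structure HybridSystem (E : Type) where
  C : Set E
  D : Set E
  F : E → E
  G : E → E

/-- `ξ` (whose values off `dom` are irrelevant) is a solution with hybrid time domain `dom`. -/
structure HybridSystem.IsSolution {E : Type} [NormedAddCommGroup E] [NormedSpace ℝ E]
    (sys : HybridSystem E) (dom : Set (ℝ × ℕ)) (ξ : ℝ → ℕ → E) : Prop where
  domain : IsHybridTimeDomain dom
  absolutelyContinuous : ∀ (j : ℕ) (a b : ℝ), a ≤ b → (a, j) ∈ dom → (b, j) ∈ dom →
    AbsolutelyContinuousOnInterval (fun t => ξ t j) a b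
  flow : ∀ j : ℕ, ∀ᵐ t : ℝ, (t, j) ∈ dom →
    ξ t j ∈ sys.C ∧ HasDerivAt (fun s => ξ s j) (sys.F (ξ t j)) t
  jump : ∀ (t : ℝ) (j : ℕ), (t, j) ∈ dom → (t, j + 1) ∈ dom →
    ξ t j ∈ sys.D ∧ ξ t (j + 1) = sys.G (ξ t j)

/-! ### The sampled-data closed loop -/

/-- Combined plant/controller state space `ℝ^{n_p + n_c}` with the Euclidean norm; a vector is
`x = (x_p, x_c)`. -/
abbrev XSpace (np nc : ℕ) : Type := EuclideanSpace ℝ (Fin np ⊕ Fin nc)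

/-- The plant block of a combined vector. -/
def plantPart {np nc : ℕ} (x : XSpace np nc) : EuclideanSpace ℝ (Fin np) :=
  WithLp.toLp 2 (fun i => x (Sum.inl i))

/-- The controller block of a combined vector. -/
def ctrlPart {np nc : ℕ} (x : XSpace np nc) : EuclideanSpace ℝ (Fin nc) :=
  WithLp.toLp 2 (fun i => x (Sum.inr i))

/-- The vector field `f(x, e)`, for the plant `x_p' = f_p(x_p, û)` and the controller
`x_c' = f_c(x_c, x̂_p)`, `u = g_c(x_c, x_p)`. The error `e` obeys `e' = g(x, e) = -f(x, e)`. -/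
def closedLoop {np nc nu : ℕ}
    (fp : EuclideanSpace ℝ (Fin np) → EuclideanSpace ℝ (Fin nu) → EuclideanSpace ℝ (Fin np))
    (fc : EuclideanSpace ℝ (Fin nc) → EuclideanSpace ℝ (Fin np) → EuclideanSpace ℝ (Fin nc))
    (gc : EuclideanSpace ℝ (Fin nc) → EuclideanSpace ℝ (Fin np) → EuclideanSpace ℝ (Fin nu))
    (x e : XSpace np nc) : XSpace np nc :=
  WithLp.toLp 2 (Sum.elim
    (fun i => fp (plantPart x) (gc (ctrlPart x + ctrlPart e) (plantPart x + plantPart e)) i)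
    (fun i => fc (ctrlPart x) (plantPart x + plantPart e) i))

/-- State space of the hybrid model: `ξ = (x, e, η, τ, h)`. -/
abbrev HState (np nc nη : ℕ) : Type :=
  XSpace np nc × XSpace np nc × EuclideanSpace ℝ (Fin nη) × ℝ × ℝ

section HStateProjections

variable {np nc nη : ℕ}

/-- The plant/controller state `x`. -/
def HState.x (ξ : HState np nc nη) : XSpace np nc := ξ.1

/-- The sampling-induced error `e`. -/
def HState.e (ξ : HState np nc nη) : XSpace np nc := ξ.2.1

/-- The dynamic variable `η`. -/
def HState.η (ξ : HState np nc nη) : EuclideanSpace ℝ (Fin nη) := ξ.2.2.1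

/-- The timer `τ`. -/
def HState.τ (ξ : HState np nc nη) : ℝ := ξ.2.2.2.1

/-- The current sampling interval `h`. -/
def HState.h (ξ : HState np nc nη) : ℝ := ξ.2.2.2.2

/-- The Euclidean norm of the stacked vector `(x, e, η)`. -/
def stackedNorm (ξ : HState np nc nη) : ℝ≥0 :=
  NNReal.sqrt (‖HState.x ξ‖₊ ^ 2 + ‖HState.e ξ‖₊ ^ 2 + ‖HState.η ξ‖₊ ^ 2)

end HStateProjections

/-- The hybrid model of the closed loop with vector field `f`, update `S` of the dynamic
variable and sampling-interval map `Γ`. -/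
def hybridLoop {np nc nη : ℕ} (f : XSpace np nc → XSpace np nc → XSpace np nc)
    (S : EuclideanSpace ℝ (Fin nη) → XSpace np nc → EuclideanSpace ℝ (Fin nη))
    (Γ : XSpace np nc → EuclideanSpace ℝ (Fin nη) → ℝ) :
    HybridSystem (HState np nc nη) where
  C := {ξ | HState.τ ξ ≤ HState.h ξ}
  D := {ξ | HState.τ ξ = HState.h ξ}
  F := fun ξ => (f (HState.x ξ) (HState.e ξ), -f (HState.x ξ) (HState.e ξ), 0, 1, 0)
  G := fun ξ => (HState.x ξ, 0, S (HState.η ξ) (HState.x ξ), 0, Γ (HState.x ξ) (HState.η ξ))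

/-- Admissible initial values of the timer variables: `h(0,0) = τ(0,0) ≥ 0`, which forces the
first sample to be taken at time `0`. -/
def InitialTimers {np nc nη : ℕ} (ξ₀ : HState np nc nη) : Prop :=
  0 ≤ HState.τ ξ₀ ∧ HState.h ξ₀ = HState.τ ξ₀

/-- The set `{x = 0, e = 0, η = 0}` is asymptotically stable with region of attraction `R`. -/
def IsAsymptoticallyStable {np nc nη : ℕ} (sys : HybridSystem (HState np nc nη))
    (R : Set (XSpace np nc)) : Prop :=
  ∃ β : ℝ≥0 → ℝ≥0 → ℝ≥0 → ℝ≥0, ClassKLL β ∧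
    ∀ (dom : Set (ℝ × ℕ)) (ξ : ℝ → ℕ → HState np nc nη), sys.IsSolution dom ξ →
      InitialTimers (ξ 0 0) → HState.x (ξ 0 0) ∈ R →
      ∀ (t : ℝ) (j : ℕ), (t, j) ∈ dom →
        stackedNorm (ξ t j) ≤ β (stackedNorm (ξ 0 0)) t.toNNReal (j : ℝ≥0)

/-- Every sampling interval of every solution has length at least `tmin`: the `j`-th sampling
instant is the time `s` at which the solution jumps from `(s, j)` to `(s, j + 1)`. -/
def InterSamplingAtLeast {np nc nη : ℕ} (sys : HybridSystem (HState np nc nη))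
    (tmin : ℝ) : Prop :=
  ∀ (dom : Set (ℝ × ℕ)) (ξ : ℝ → ℕ → HState np nc nη), sys.IsSolution dom ξ →
    InitialTimers (ξ 0 0) →
    ∀ (j : ℕ) (s s' : ℝ), (s, j) ∈ dom → (s, j + 1) ∈ dom →
      (s', j + 1) ∈ dom → (s', j + 2) ∈ dom → tmin ≤ s' - s

/-! ### The Lyapunov assumption -/

/-- The hybrid Lyapunov assumption on the sets `𝒳`, `ℰ` for the function `V` and the parameters
`ε`, `γ`, `L`. Locally Lipschitz functions are differentiable almost everywhere on the interior
of their domain; the two differential inequalities are only asked for where the gradient exists.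
`fderiv ℝ V x v` is the pairing of the gradient of `V` at `x` with `v`. -/
def HybridLyapunov {np nc : ℕ} (f : XSpace np nc → XSpace np nc → XSpace np nc)
    (𝒳 ℰ : Set (XSpace np nc)) (V : XSpace np nc → ℝ) (ε γ L : ℝ) : Prop :=
  0 < L ∧ 0 < γ ∧ LocallyLipschitzOn 𝒳 V ∧ (∀ x ∈ 𝒳, 0 ≤ V x) ∧
  ∃ (W : XSpace np nc → ℝ) (H : XSpace np nc → XSpace np nc → ℝ)
    (αW αW' αV αV' : ℝ≥0 → ℝ≥0),
    LocallyLipschitzOn ℰ W ∧ (∀ e ∈ ℰ, 0 ≤ W e) ∧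
    ContinuousOn (fun p : XSpace np nc × XSpace np nc => H p.1 p.2) (𝒳 ×ˢ ℰ) ∧
    (∀ x ∈ 𝒳, ∀ e ∈ ℰ, 0 ≤ H x e) ∧
    ClassKInf αW ∧ ClassKInf αW' ∧ ClassKInf αV ∧ ClassKInf αV' ∧
    (∀ e ∈ ℰ, (αW ‖e‖₊ : ℝ) ≤ W e ∧ W e ≤ αW' ‖e‖₊) ∧
    (∀ x ∈ 𝒳, (αV ‖x‖₊ : ℝ) ≤ V x ∧ V x ≤ αV' ‖x‖₊) ∧
    (∀ x ∈ 𝒳, ∀ᵐ e : XSpace np nc, e ∈ ℰ → DifferentiableAt ℝ W e →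
      fderiv ℝ W e (-f x e) ≤ L * W e + H x e) ∧
    (∀ e ∈ ℰ, ∀ᵐ x : XSpace np nc, x ∈ 𝒳 → DifferentiableAt ℝ V x →
      fderiv ℝ V x (f x e) ≤ -ε * V x - H x e ^ 2 + γ ^ 2 * W e ^ 2)

/-! ### The self-triggered mechanism -/

/-- The function `T_max(γ, Λ)`. -/
def Tmax (γ Λ : ℝ) : ℝ :=
  let r := √|(γ / Λ) ^ 2 - 1|
  if Λ < γ then Real.arctan r / (Λ * r)
  else if γ = Λ then 1 / Λ
  else Real.artanh r / (Λ * r)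

/-- The window update `S(η, x) = (η_2, …, η_{m-1}, V(x))` of `η ∈ ℝ^{m-1}`. -/
def windowUpdate {np nc : ℕ} (V : XSpace np nc → ℝ) (m : ℕ)
    (η : EuclideanSpace ℝ (Fin (m - 1))) (x : XSpace np nc) : EuclideanSpace ℝ (Fin (m - 1)) :=
  WithLp.toLp 2 (fun k => if hk : k.val + 1 < m - 1 then η ⟨k.val + 1, hk⟩ else V x)

/-- `C(x, η, c) = min {c, (V(x) + ∑_k η_k) / m}`. -/
def windowBound {np nc : ℕ} (V : XSpace np nc → ℝ) (c : ℝ) (m : ℕ)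
    (x : XSpace np nc) (η : EuclideanSpace ℝ (Fin (m - 1))) : ℝ :=
  min c ((V x + ∑ k, η k) / m)

/-- The candidate interval computed in the loop of the algorithm for one parameter set
`(ε, γ, L)`, from the numbers `v = V(x)` and `C = C(x, η, c)`. The logarithms follow the
convention `log s = -∞` for `s ≤ 0`: in the first case with `v = 0` (so `v ≤ C`) the constraint
`(-ε + εref) h ≤ log (C / v)` is void, and in the second case with `C ≤ 0` it has no solution. -/
def candidate (δ εref ε γ L v C : ℝ) : ℝ :=
  let T := δ * Tmax γ (max (L + ε / 2) (1 - δ))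
  if v ≤ C then
    if 0 < -ε + εref then
      if v = 0 then T else min T ((Real.log C - Real.log v) / (-ε + εref))
    else T
  else
    if 0 ≤ -ε + εref then 0
    else if 0 < C ∧ (Real.log C - Real.log v) / (-ε + εref) < T then T
    else 0

/-- The minimal sampling interval, also the fall-back: `δ T_max(γ₁, L₁ + ε₁ / 2)`. -/
def fallback (δ ε γ L : ℝ) : ℝ := δ * Tmax γ (L + ε / 2)

/-- The map `Γ` computed by the algorithm. There are `n + 1` parameter sets; the index `0` is the
distinguished set used for the fall-back, and the loop runs over the others in order. -/
def algorithmΓ {np nc n : ℕ} (V : XSpace np nc → ℝ) (c : ℝ) (m : ℕ) (δ εref : ℝ)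
    (ε γ L : Fin (n + 1) → ℝ)
    (x : XSpace np nc) (η : EuclideanSpace ℝ (Fin (m - 1))) : ℝ :=
  (List.finRange n).foldl
    (fun h i =>
      let hi := candidate δ εref (ε i.succ) (γ i.succ) (L i.succ) (V x) (windowBound V c m x η)
      if h < hi then hi else h)
    (fallback δ (ε 0) (γ 0) (L 0))

end DynSTC

end

/-!
# Stability of a dynamic self-triggered sampling mechanism

Between two samples the error satisfies `e = x̂ - x`, where `x̂` is the last sample, and since `f` is
continuous the absolutely continuous solution is a classical one. For a parameter set `(ε, γ, L)`
the function `U = V(x) + γ φ W(e)²` decays at rate `ε`, provided that `φ ≥ 0` solves the Riccati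
equation `φ' = -2 Λ φ - γ (φ² + 1)` with `Λ ≥ L + ε / 2`; such a `φ` exists on every interval
shorter than `Tmax γ Λ`, which is the time a solution needs to fall from `+∞` to `0`
(`exists_riccati_of_lt_Tmax`). As `W(e) = 0` at the sample, this gives
`V(x(s)) ≤ exp (-ε s) V(x̂)` (`le_exp_of_flow`).

The gradient inequalities hold only almost everywhere. Rademacher's theorem and Fubini's theorem
along lines turn them into bounds for increments of `V` and `W` (`sub_le_mul_of_ae_fderiv_le`) and
then for the upper right Dini derivatives along trajectories (`eventually_slope_comp_lt`). This
needs `x` and `e` to be interior points of `𝒳` and `ℰ`, which is the case as long as `V(x) < c`. If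
the sample itself lies at level `c`, it is approximated by points of lower level: translates of
the trajectory that start there decrease at a uniform rate, and so does, in the limit, the
trajectory (`HybridLyapunov.exists_lt_of_flow`). The level `c` is not reached again, because every
interval that the mechanism selects satisfies `exp (-ε s) V(x̂) < c` for `0 < s ≤ Γ`
(`algorithmΓ_spec`).

The same lemma shows that `V` at the next sample is at most `ρ < 1` times the maximum of `V` at this
sample and of the window average. Hence the samples `yₖ` of `V` obey `yₖ ≤ A λ ^ (k + m - 1)` with
`λ ^ m = ρ`, and the entries of `η` decay accordingly (`StandingAssumptions.sample_bounds`). Since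
the sampling intervals are bounded, decay in the number of jumps is also decay in time, and the
class `𝒦ℒℒ` bound has the form `Ψ (B(q) exp (-a t) exp (-b j))`.
-/

namespace DynSTC

/-! ### Dini derivatives from almost-everywhere gradient bounds -/

section Dini

variable {E : Type*} [NormedAddCommGroup E] [NormedSpace ℝ E] [FiniteDimensional ℝ E]
  [MeasurableSpace E] [BorelSpace E]

/-- A Lipschitz function whose derivative in the direction `v` is at most `M` almost everywhere grows
at rate at most `M` along every segment in that direction: this is clear on almost every line, where
the derivative bound holds almost everywhere, and follows on all lines by density. -/
theorem sub_le_mul_of_ae_fderiv_le (μ : Measure E) [μ.IsAddHaarMeasure] {U : E → ℝ} {K : ℝ≥0}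
    {B : Set E} (hB : IsOpen B) (hBc : Convex ℝ B) (hU : LipschitzOnWith K U B) {v : E} {M : ℝ}
    (h : ∀ᵐ y ∂μ, y ∈ B → DifferentiableAt ℝ U y → fderiv ℝ U y v ≤ M)
    {y : E} {s : ℝ} (hs : 0 ≤ s) (hy : y ∈ B) (hys : y + s • v ∈ B) :
    U (y + s • v) - U y ≤ M * s := by
  have hgood : ∀ᵐ y ∂μ, y ∈ B → DifferentiableAt ℝ U y ∧ fderiv ℝ U y v ≤ M := by
    filter_upwards [h, hU.ae_differentiableWithinAt_of_mem (μ := μ)] with z hz1 hz2 hzB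
    have := (hz2 hzB).differentiableAt (hB.mem_nhds hzB)
    exact ⟨this, hz1 hzB this⟩
  obtain ⟨G, hGae, hGm, hG⟩ := hgood.exists_measurable_mem
  have hline := (ae_ae_add_linearMap_mem_iff (LinearMap.toSpanSingleton ℝ E v) volume μ hGm).2 hGae
  simp only [LinearMap.toSpanSingleton_apply] at hline
  -- the estimate on almost every line parallel to `v`
  have key : ∀ᵐ z ∂μ, z ∈ B → z + s • v ∈ B → U (z + s • v) - U z ≤ M * s := by
    filter_upwards [hline] with z hz hzB hzsB
    have hseg : ∀ t ∈ Set.Icc 0 s, z + t • v ∈ B := by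
      intro t ht
      rcases hs.eq_or_lt with h0 | h0
      · have : t = 0 := le_antisymm (by rw [h0]; exact ht.2) ht.1
        simpa [this] using hzB
      · have := hBc.add_smul_sub_mem hzB hzsB (t := t / s) ⟨by have := ht.1; positivity, by
          rw [div_le_one h0]; exact ht.2⟩
        rwa [add_sub_cancel_left, smul_smul, div_mul_cancel₀ _ h0.ne'] at this
    have hLip : LipschitzOnWith (K * ‖v‖₊) (fun t : ℝ => U (z + t • v)) (Set.uIcc 0 s) := by
      rw [Set.uIcc_of_le hs]
      have h1 : LipschitzOnWith ‖v‖₊ (fun t : ℝ => z + t • v) (Set.Icc 0 s) := by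
        apply LipschitzOnWith.of_dist_le_mul
        intro a _ b _
        rw [dist_add_left, dist_eq_norm, ← sub_smul, norm_smul, mul_comm]
        rfl
      exact hU.comp h1 hseg
    have hac := hLip.absolutelyContinuousOnInterval
    have hint := hac.integral_deriv_eq_sub
    simp only [zero_smul, add_zero] at hint
    rw [← hint]
    have : ∫ t in (0 : ℝ)..s, deriv (fun t : ℝ => U (z + t • v)) t ≤ ∫ t in (0 : ℝ)..s, M := by
      apply intervalIntegral.integral_mono_ae_restrict hs hac.intervalIntegrable_deriv
        intervalIntegrable_const
      rw [EventuallyLE, ae_restrict_iff' measurableSet_Icc]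
      filter_upwards [hz] with t ht htI
      obtain ⟨hd, hle⟩ := hG _ ht (hseg t htI)
      have h2 : HasDerivAt (fun t : ℝ => z + t • v) v t := by
        simpa using ((hasDerivAt_id t).smul_const v).const_add z
      have h3 := hd.hasFDerivAt.comp_hasDerivAt t h2
      have h4 : deriv (fun t : ℝ => U (z + t • v)) t = fderiv ℝ U (z + t • v) v := h3.deriv
      rw [h4]; exact hle
    simpa [mul_comm] using this
  -- extension to every line by density
  have hdense : Dense {z | z ∈ B → z + s • v ∈ B → U (z + s • v) - U z ≤ M * s} :=
    Measure.dense_of_ae key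
  have hcont : ContinuousAt (fun z => U (z + s • v) - U z) y := by
    have h1 : ContinuousAt U (y + s • v) := hU.continuousOn.continuousAt (hB.mem_nhds hys)
    have h2 : ContinuousAt U y := hU.continuousOn.continuousAt (hB.mem_nhds hy)
    have h3 : ContinuousAt (fun z : E => z + s • v) y := by fun_prop
    exact (ContinuousAt.comp (f := fun z : E => z + s • v) h1 h3).sub h2
  refine le_of_tendsto_of_frequently hcont.tendsto ?_
  have h1 : ∀ᶠ z in 𝓝 y, z ∈ B := hB.mem_nhds hy
  have h2 : ∀ᶠ z in 𝓝 y, z + s • v ∈ B :=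
    (show ContinuousAt (fun z : E => z + s • v) y by fun_prop).eventually_mem (hB.mem_nhds hys)
  have h3 := mem_closure_iff_frequently.1 (hdense y)
  exact (h3.and_eventually (h1.and h2)).mono fun z hz => hz.1 hz.2.1 hz.2.2

/-- If `fderiv ℝ U y (F y) ≤ P y` for almost all `y` near `z t`, then `U` along a curve `z` with right
derivative `v` has upper right Dini derivative at most `P + K ‖v - F‖` at `t`. -/
theorem eventually_slope_comp_lt (μ : Measure E) [μ.IsAddHaarMeasure] {U : E → ℝ} {K : ℝ≥0}
    {N : Set E} {F : E → E} {P : E → ℝ} {z : ℝ → E} {v : E} {t r : ℝ}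
    (hN : N ∈ 𝓝 (z t)) (hU : LipschitzOnWith K U N)
    (hF : ContinuousAt F (z t)) (hP : ContinuousAt P (z t))
    (h : ∀ᵐ y ∂μ, y ∈ N → DifferentiableAt ℝ U y → fderiv ℝ U y (F y) ≤ P y)
    (hz : HasDerivWithinAt z v (Set.Ici t) t)
    (hr : P (z t) + K * ‖v - F (z t)‖ < r) :
    ∀ᶠ s in 𝓝[>] t, slope (fun s => U (z s)) t s < r := by
  obtain ⟨r', hr1, hr2⟩ := exists_between hr
  have hcont : ContinuousAt (fun y => P y + K * ‖v - F y‖) (z t) := by fun_prop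
  have hev : ∀ᶠ y in 𝓝 (z t), P y + K * ‖v - F y‖ < r' := hcont.eventually_lt_const hr1
  obtain ⟨ρ, hρ, hball⟩ := Metric.eventually_nhds_iff_ball.1 (hev.and hN)
  set B := Metric.ball (z t) ρ with hBdef
  have hUB : LipschitzOnWith K U B := hU.mono fun y hy => (hball y hy).2
  have hBo : IsOpen B := Metric.isOpen_ball
  have hle : ∀ᵐ y ∂μ, y ∈ B → DifferentiableAt ℝ U y → fderiv ℝ U y v ≤ r' := by
    filter_upwards [h] with y hy hyB hyd
    have h1 := hy (hball y hyB).2 hyd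
    have h2 : ‖fderiv ℝ U y‖ ≤ K := norm_fderiv_le_of_lipschitzOn ℝ (hBo.mem_nhds hyB) hUB
    have h3 : fderiv ℝ U y (v - F y) ≤ K * ‖v - F y‖ :=
      (le_abs_self _).trans (((fderiv ℝ U y).le_opNorm _).trans (by gcongr))
    have h4 : fderiv ℝ U y v = fderiv ℝ U y (F y) + fderiv ℝ U y (v - F y) := by
      rw [← map_add]; congr 1; abel
    have h5 := (hball y hyB).1
    linarith
  have hdir : ∀ᶠ s in 𝓝[>] t, z t + (s - t) • v ∈ B := by
    have : ContinuousAt (fun s : ℝ => z t + (s - t) • v) t := by fun_prop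
    have h2 := this.eventually_mem (s := B) (by
      simpa using Metric.ball_mem_nhds (z t) hρ)
    exact h2.filter_mono nhdsWithin_le_nhds
  have hzB : ∀ᶠ s in 𝓝[>] t, z s ∈ B :=
    ((hz.continuousWithinAt.mono Set.Ioi_subset_Ici_self).tendsto).eventually_mem
      (Metric.ball_mem_nhds _ hρ)
  obtain ⟨κ, hκ0, hκ⟩ : ∃ κ : ℝ, 0 < κ ∧ r' + K * κ < r := by
    refine ⟨(r - r') / (2 * (K + 1)), by have := sub_pos.2 hr2; positivity, ?_⟩
    have h1 : (K : ℝ) * ((r - r') / (2 * (K + 1))) = (r - r') / 2 * (K / (K + 1)) := by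
      field_simp
    have h2 : (K : ℝ) / (K + 1) ≤ 1 := by rw [div_le_one (by positivity)]; linarith
    have h3 : 0 < (r - r') / 2 := by linarith
    rw [h1]; nlinarith
  have hlo : ∀ᶠ s in 𝓝[>] t, ‖z s - z t - (s - t) • v‖ ≤ κ * ‖s - t‖ :=
    ((hasDerivWithinAt_iff_isLittleO.1 hz).bound hκ0).filter_mono
      (nhdsWithin_mono _ Set.Ioi_subset_Ici_self)
  filter_upwards [hdir, hzB, hlo, self_mem_nhdsWithin] with s h1 h2 h3 (h4 : t < s)
  have h5 := sub_le_mul_of_ae_fderiv_le μ hBo (convex_ball _ _) hUB hle (s := s - t)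
    (by linarith) (Metric.mem_ball_self hρ) h1
  have h6 : U (z s) - U (z t + (s - t) • v) ≤ K * (κ * (s - t)) := by
    have := hUB.dist_le_mul _ h2 _ h1
    rw [Real.dist_eq, dist_eq_norm, ← sub_sub] at this
    rw [Real.norm_of_nonneg (by linarith : 0 ≤ s - t)] at h3
    calc _ ≤ _ := le_abs_self _
      _ ≤ _ := this
      _ ≤ _ := by gcongr
  rw [slope_def_field, div_lt_iff₀ (by linarith)]
  have : (r' + K * κ) * (s - t) < r * (s - t) := by
    apply mul_lt_mul_of_pos_right hκ; linarith
  nlinarith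

end Dini

/-! ### The Riccati equation behind `Tmax` -/

theorem Tmax_pos {γ Λ : ℝ} (hγ : 0 < γ) (hΛ : 0 < Λ) : 0 < Tmax γ Λ := by
  unfold Tmax
  have hq : 0 < γ / Λ := by positivity
  split_ifs with h1 h2
  · have : 1 < γ / Λ := by rwa [one_lt_div hΛ]
    have hr : 0 < √|(γ / Λ) ^ 2 - 1| := Real.sqrt_pos.2 (abs_pos.2 (by nlinarith))
    have := Real.arctan_pos.2 hr
    positivity
  · positivity
  · have h3 : γ / Λ < 1 := by
      rw [div_lt_one hΛ]; exact lt_of_le_of_ne (not_lt.1 h1) h2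
    have hr : 0 < √|(γ / Λ) ^ 2 - 1| := Real.sqrt_pos.2 (abs_pos.2 (by nlinarith))
    have hr1 : √|(γ / Λ) ^ 2 - 1| < 1 := by
      rw [Real.sqrt_lt' one_pos, abs_lt]; constructor <;> nlinarith
    have := Real.artanh_pos ⟨hr, hr1⟩
    positivity

/-- The linear equation `S'' = (Λ² - γ²) S`, `S(0) = 0`, `S'(0) = 1` linearizes the Riccati equation;
`Tmax γ Λ` is the first zero of `S' - Λ S`. -/
theorem exists_linear_of_lt_Tmax {γ Λ T : ℝ} (hγ : 0 < γ) (hΛ : 0 < Λ) (hT : T < Tmax γ Λ) :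
    ∃ S S' : ℝ → ℝ, (∀ t, HasDerivAt S (S' t) t) ∧
      (∀ t, HasDerivAt S' ((Λ ^ 2 - γ ^ 2) * S t) t) ∧
      ∀ t ∈ Set.Icc 0 T, 0 ≤ S t ∧ 0 < S' t - Λ * S t := by
  unfold Tmax at hT
  have hq : 0 < γ / Λ := by positivity
  set r := √|(γ / Λ) ^ 2 - 1| with hr
  split_ifs at hT with h1 h2
  · have h3 : 1 < γ / Λ := by rwa [one_lt_div hΛ]
    have hr0 : 0 < r := Real.sqrt_pos.2 (abs_pos.2 (by nlinarith))
    have hr2 : r ^ 2 = (γ / Λ) ^ 2 - 1 := by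
      rw [hr, Real.sq_sqrt (abs_nonneg _), abs_of_pos (by nlinarith)]
    have hω : 0 < Λ * r := by positivity
    have hω2 : (Λ * r) ^ 2 = γ ^ 2 - Λ ^ 2 := by rw [mul_pow, hr2]; field_simp
    refine ⟨fun t => Real.sin (Λ * r * t) / (Λ * r), fun t => Real.cos (Λ * r * t), ?_, ?_, ?_⟩
    · intro t
      have := ((Real.hasDerivAt_sin (Λ * r * t)).comp t
        ((hasDerivAt_id t).const_mul (Λ * r))).div_const (Λ * r)
      refine this.congr_deriv ?_
      field_simp
    · intro t
      have := (Real.hasDerivAt_cos (Λ * r * t)).comp t ((hasDerivAt_id t).const_mul (Λ * r))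
      refine this.congr_deriv ?_
      have : Λ ^ 2 - γ ^ 2 = -(Λ * r) ^ 2 := by rw [hω2]; ring
      rw [this]; field_simp
    · intro t ht
      have ha0 : 0 ≤ Λ * r * t := mul_nonneg hω.le ht.1
      have ha1 : Λ * r * t < Real.arctan r := by
        have h4 := lt_of_le_of_lt ht.2 hT
        rw [lt_div_iff₀ hω] at h4; linarith
      have hπ := Real.arctan_lt_pi_div_two r
      have hcos : 0 < Real.cos (Λ * r * t) :=
        Real.cos_pos_of_mem_Ioo ⟨by linarith [Real.pi_pos], by linarith⟩
      refine ⟨div_nonneg (Real.sin_nonneg_of_nonneg_of_le_pi ha0 (by linarith [Real.pi_pos]))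
        hω.le, ?_⟩
      have htan : Real.tan (Λ * r * t) < r := by
        have := Real.tan_lt_tan_of_lt_of_lt_pi_div_two (by linarith [Real.pi_pos]) hπ ha1
        rwa [Real.tan_arctan] at this
      rw [Real.tan_eq_sin_div_cos, div_lt_iff₀ hcos] at htan
      have h5 : Λ * (Real.sin (Λ * r * t) / (Λ * r)) = Real.sin (Λ * r * t) / r := by field_simp
      rw [h5, sub_pos, div_lt_iff₀ hr0]; linarith
  · subst h2
    refine ⟨fun t => t, fun _ => 1, hasDerivAt_id, fun t => ?_, fun t ht => ⟨ht.1, ?_⟩⟩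
    · simpa using hasDerivAt_const t (1 : ℝ)
    · have h4 := lt_of_le_of_lt ht.2 hT
      rw [lt_div_iff₀ hγ] at h4
      linarith
  · have h3 : γ / Λ < 1 := by
      rw [div_lt_one hΛ]; exact lt_of_le_of_ne (not_lt.1 h1) h2
    have hr0 : 0 < r := Real.sqrt_pos.2 (abs_pos.2 (by nlinarith))
    have hr2 : r ^ 2 = 1 - (γ / Λ) ^ 2 := by
      rw [hr, Real.sq_sqrt (abs_nonneg _), abs_of_neg (by nlinarith)]; ring
    have hω : 0 < Λ * r := by positivity
    have hω2 : (Λ * r) ^ 2 = Λ ^ 2 - γ ^ 2 := by rw [mul_pow, hr2]; field_simp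
    refine ⟨fun t => Real.sinh (Λ * r * t) / (Λ * r), fun t => Real.cosh (Λ * r * t), ?_, ?_, ?_⟩
    · intro t
      have := ((Real.hasDerivAt_sinh (Λ * r * t)).comp t
        ((hasDerivAt_id t).const_mul (Λ * r))).div_const (Λ * r)
      refine this.congr_deriv ?_
      field_simp
    · intro t
      have := (Real.hasDerivAt_cosh (Λ * r * t)).comp t ((hasDerivAt_id t).const_mul (Λ * r))
      refine this.congr_deriv ?_
      rw [← hω2]; field_simp
    · intro t ht
      have ha0 : 0 ≤ Λ * r * t := mul_nonneg hω.le ht.1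
      have ha1 : Λ * r * t < Real.artanh r := by
        have h4 := lt_of_le_of_lt ht.2 hT
        rw [lt_div_iff₀ hω] at h4; linarith
      refine ⟨div_nonneg (Real.sinh_nonneg_iff.2 ha0) hω.le, ?_⟩
      have hcosh := Real.cosh_pos (Λ * r * t)
      have htanh : Real.tanh (Λ * r * t) < r := by
        by_contra! hcon
        have := Real.artanh_le_artanh (by linarith) (Real.tanh_lt_one (Λ * r * t)) hcon
        rw [Real.artanh_tanh] at this
        linarith
      rw [Real.tanh_eq_sinh_div_cosh, div_lt_iff₀ hcosh] at htanh
      have h5 : Λ * (Real.sinh (Λ * r * t) / (Λ * r)) = Real.sinh (Λ * r * t) / r := by field_simp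
      rw [h5, sub_pos, div_lt_iff₀ hr0]; linarith

/-- In reversed time `ψ(s) = φ(T - s)` the solution is `ψ = γ S / (S' - Λ S)`, with `ψ(0) = 0`. -/
theorem exists_riccati_of_lt_Tmax {γ Λ T : ℝ} (hγ : 0 < γ) (hΛ : 0 < Λ) (hT : T < Tmax γ Λ) :
    ∃ φ : ℝ → ℝ, ∀ s ∈ Set.Icc 0 T, 0 ≤ φ s ∧
      HasDerivAt φ (-(γ + 2 * Λ * φ s + γ * φ s ^ 2)) s := by
  obtain ⟨S, S', hS, hS', hpos⟩ := exists_linear_of_lt_Tmax hγ hΛ hT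
  refine ⟨fun s => γ * S (T - s) / (S' (T - s) - Λ * S (T - s)), fun s hs => ?_⟩
  obtain ⟨h1, h2⟩ := hpos (T - s) ⟨by linarith [hs.2], by linarith [hs.1]⟩
  refine ⟨by positivity, ?_⟩
  have hrev : HasDerivAt (fun s => T - s) (-1) s := by simpa using (hasDerivAt_id s).const_sub T
  have hN := (hS (T - s)).comp s hrev
  have hD := (hS' (T - s)).comp s hrev
  refine ((hN.const_mul γ).div (hD.sub (hN.const_mul Λ)) h2.ne').congr_deriv ?_
  have h3 := h2.ne'
  simp only [Function.comp, Pi.sub_apply]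
  generalize S (T - s) = a at *
  generalize S' (T - s) = b at *
  rw [div_eq_iff (pow_ne_zero 2 h3)]
  field_simp
  ring

/-! ### Decrease of the Lyapunov function near a positive level -/

section Flow

variable {np nc : ℕ} {f : XSpace np nc → XSpace np nc → XSpace np nc}
  {𝒳 ℰ : Set (XSpace np nc)} {V : XSpace np nc → ℝ} {ε γ L c : ℝ}

/-- Near a point with `V > 0`, and for a small error, `V` decreases at a uniform rate along every curve
whose velocity is close to `f x₀ 0`. -/
theorem HybridLyapunov.exists_slope_lt_neg (hf : Continuous fun p : _ × _ => f p.1 p.2)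
    (hL : HybridLyapunov f 𝒳 ℰ V ε γ L) (hε : 0 < ε) (hV : Continuous V)
    {x₀ : XSpace np nc} (hx₀ : x₀ ∈ 𝒳) (hpos : 0 < V x₀) :
    ∃ ρ > 0, ∃ μ > 0, ∀ (ζ : ℝ → XSpace np nc) (t : ℝ) (e w : XSpace np nc),
      ζ t ∈ interior 𝒳 → e ∈ ℰ → dist (ζ t) x₀ < ρ → ‖e‖ < ρ → dist w (f x₀ 0) < ρ →
      HasDerivWithinAt ζ w (Set.Ici t) t →
      ∀ᶠ s in 𝓝[>] t, slope (fun s => V (ζ s)) t s < -μ := by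
  obtain ⟨-, -, hVL, -, W, H, αW, αW', αV, αV', -, hW0, -, -, -, hαW', -, -, hWb, -, -, hVd⟩ := hL
  obtain ⟨K, N, hN, hK⟩ := hVL hx₀
  obtain ⟨O, hO, hxO, hON⟩ := mem_nhdsWithin.1 hN
  have hQ : Continuous fun p : XSpace np nc × XSpace np nc × XSpace np nc =>
      -ε * V p.1 + γ ^ 2 * (αW' ‖p.2.1‖₊ : ℝ) ^ 2 + K * ‖p.2.2 - f p.1 p.2.1‖ := by
    have h1 : Continuous fun p : XSpace np nc × XSpace np nc × XSpace np nc => αW' ‖p.2.1‖₊ :=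
      hαW'.continuous.comp (by fun_prop)
    have h2 : Continuous fun p : XSpace np nc × XSpace np nc × XSpace np nc => f p.1 p.2.1 :=
      hf.comp (f := fun p : XSpace np nc × XSpace np nc × XSpace np nc => (p.1, p.2.1))
        (by fun_prop)
    exact ((continuous_const.mul (hV.comp continuous_fst)).add (continuous_const.mul
      ((NNReal.continuous_coe.comp h1).pow 2))).add
      (continuous_const.mul ((continuous_snd.snd.sub h2).norm))
  have hev := (hQ.tendsto (x₀, 0, f x₀ 0)).eventually_lt_const
    (u := -(ε * V x₀ / 2)) (by
      have : 0 < ε * V x₀ := by positivity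
      simp [hαW'.map_zero]; linarith)
  have hevO : ∀ᶠ p : XSpace np nc × XSpace np nc × XSpace np nc in 𝓝 (x₀, 0, f x₀ 0), p.1 ∈ O :=
    continuous_fst.continuousAt.eventually_mem (hO.mem_nhds hxO)
  obtain ⟨ρ, hρ, hball⟩ := Metric.eventually_nhds_iff.1 (hev.and hevO)
  refine ⟨ρ, hρ, ε * V x₀ / 2, by positivity, fun ζ t e w hζ he h1 h2 h3 hd => ?_⟩
  obtain ⟨h4, h5⟩ := @hball (ζ t, e, w) (by
    rw [Prod.dist_eq, Prod.dist_eq]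
    simp [h1, h2, h3])
  refine eventually_slope_comp_lt (volume : Measure (XSpace np nc)) (U := V) (K := K)
    (N := O ∩ interior 𝒳) (F := fun y => f y e)
    (P := fun y => -ε * V y + γ ^ 2 * (αW' ‖e‖₊ : ℝ) ^ 2)
    ((hO.inter isOpen_interior).mem_nhds ⟨h5, hζ⟩)
    (hK.mono fun y hy => hON ⟨hy.1, interior_subset hy.2⟩)
    (hf.comp (f := fun y : XSpace np nc => (y, e)) (by fun_prop)).continuousAt
    (by fun_prop) ?_ hd h4
  filter_upwards [hVd e he] with y hy hyN hyd
  have h6 := hy (interior_subset hyN.2) hyd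
  have h7 := (hWb e he).2
  have h8 := hW0 e he
  have h9 : γ ^ 2 * W e ^ 2 ≤ γ ^ 2 * (αW' ‖e‖₊ : ℝ) ^ 2 := by gcongr
  nlinarith [sq_nonneg (H y e)]

/-- An interior point with `V > 0` is no local minimum of `V`: with zero error `V` decreases along the
vector field. -/
theorem HybridLyapunov.mem_closure_lt (hf : Continuous fun p : _ × _ => f p.1 p.2)
    (hL : HybridLyapunov f 𝒳 ℰ V ε γ L) (hε : 0 < ε) (hV : Continuous V)
    (h0 : (0 : XSpace np nc) ∈ ℰ)
    {x₀ : XSpace np nc} (hx₀ : x₀ ∈ interior 𝒳) (hpos : 0 < V x₀) :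
    x₀ ∈ closure {y | V y < V x₀} := by
  obtain ⟨ρ, hρ, μ, hμ, h⟩ := hL.exists_slope_lt_neg hf hε hV (interior_subset hx₀) hpos
  have hd : HasDerivAt (fun s : ℝ => x₀ + s • f x₀ 0) (f x₀ 0) 0 := by
    simpa using ((hasDerivAt_id (0 : ℝ)).smul_const (f x₀ 0)).const_add x₀
  have h1 := h (fun s => x₀ + s • f x₀ 0) 0 0 (f x₀ 0) (by simpa using hx₀) h0 (by simpa using hρ)
    (by simpa using hρ) (by simpa using hρ) hd.hasDerivWithinAt
  have h2 : Tendsto (fun s : ℝ => x₀ + s • f x₀ 0) (𝓝[>] 0) (𝓝 x₀) := by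
    simpa using hd.continuousAt.tendsto.mono_left nhdsWithin_le_nhds
  refine mem_closure_of_tendsto h2 ?_
  filter_upwards [h1, self_mem_nhdsWithin] with s hs (hs0 : 0 < s)
  rw [slope_def_field, div_lt_iff₀ (by linarith)] at hs
  simp only [zero_smul, add_zero, sub_zero] at hs
  show V _ < V x₀
  nlinarith

/-- A trajectory starting at a sample `x₀`, possibly on the boundary of `𝒳`, enters the
set `{V < V x₀}` immediately, if `x₀` is a limit of points of this set. -/
theorem HybridLyapunov.exists_lt_of_flow (hf : Continuous fun p : _ × _ => f p.1 p.2)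
    (hL : HybridLyapunov f 𝒳 ℰ V ε γ L) (hε : 0 < ε) (hV : Continuous V)
    (hℰ : ℰ ∈ 𝓝 (0 : XSpace np nc)) {x₀ : XSpace np nc} (hx₀ : x₀ ∈ 𝒳) (hpos : 0 < V x₀)
    (h𝒳 : {y | V y < V x₀} ⊆ 𝒳) (hcl : x₀ ∈ closure {y | V y < V x₀})
    {x : ℝ → XSpace np nc} {ℓ : ℝ} (hℓ : 0 < ℓ) (hx0 : x 0 = x₀)
    (hxc : ContinuousOn x (Set.Icc 0 ℓ))
    (hx : ∀ s ∈ Set.Ico 0 ℓ, HasDerivWithinAt x (f (x s) (x₀ - x s)) (Set.Ici s) s) :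
    ∃ s₀ ∈ Set.Ioc 0 ℓ, ∀ s ∈ Set.Ioc 0 s₀, V (x s) < V x₀ := by
  obtain ⟨ρ, hρ, μ, hμ, h⟩ := hL.exists_slope_lt_neg hf hε hV hx₀ hpos
  -- a time `s₀` up to which the trajectory stays close to its initial value
  have hnear : ∀ᶠ y in 𝓝 x₀, dist y x₀ < ρ / 2 ∧ x₀ - y ∈ ℰ ∧ ‖x₀ - y‖ < ρ ∧
      dist (f y (x₀ - y)) (f x₀ 0) < ρ := by
    have h1 : Tendsto (fun y => x₀ - y) (𝓝 x₀) (𝓝 0) := by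
      simpa using (show Continuous fun y : XSpace np nc => x₀ - y by fun_prop).tendsto x₀
    have h2 : Tendsto (fun y => f y (x₀ - y)) (𝓝 x₀) (𝓝 (f x₀ 0)) := by
      simpa [Function.comp_def] using
        (hf.comp (f := fun y : XSpace np nc => (y, x₀ - y)) (by fun_prop)).tendsto x₀
    filter_upwards [Metric.ball_mem_nhds x₀ (half_pos hρ), h1.eventually_mem hℰ,
      h1.eventually_mem (Metric.ball_mem_nhds 0 hρ),
      h2.eventually_mem (Metric.ball_mem_nhds _ hρ)] with y h3 h4 h5 h6
    exact ⟨h3, h4, by simpa using h5, h6⟩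
  have hx0c : Tendsto x (𝓝[≥] 0) (𝓝 x₀) := by
    have := (hxc 0 ⟨le_rfl, hℓ.le⟩).tendsto
    rwa [hx0, nhdsWithin_Icc_eq_nhdsGE hℓ] at this
  obtain ⟨s₀, hs₀, hs₀x⟩ := (mem_nhdsGE_iff_exists_mem_Ioc_Ico_subset hℓ).1
    (hx0c.eventually hnear)
  refine ⟨s₀, hs₀, ?_⟩
  -- translates of the trajectory that start below the level decrease at a uniform rate
  have key : ∀ y, V y < V x₀ → dist y x₀ < ρ / 2 →
      ∀ s ∈ Set.Icc 0 s₀, V (y + (x s - x₀)) ≤ V x₀ - μ * s := by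
    intro y hy hyd
    have hcont : ContinuousOn (fun s => V (y + (x s - x₀)) + μ * s) (Set.Icc 0 s₀) := by
      have := hxc.mono (Set.Icc_subset_Icc_right hs₀.2)
      fun_prop
    have hsub : Set.Icc 0 s₀ ⊆ {s | V (y + (x s - x₀)) + μ * s ≤ V y} := by
      refine IsClosed.Icc_subset_of_forall_exists_gt ?_ ?_ ?_
      · rw [Set.inter_comm]
        exact hcont.preimage_isClosed_of_isClosed isClosed_Icc isClosed_Iic
      · simp [hx0]
      · rintro s ⟨hs1, hs2⟩ b (hb : s < b)
        have hs1' : V (y + (x s - x₀)) + μ * s ≤ V y := hs1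
        obtain ⟨n1, n2, n3, n4⟩ := hs₀x ⟨hs2.1, hs2.2⟩
        have hlt : V (y + (x s - x₀)) < V x₀ := by nlinarith [hs2.1]
        have hint : y + (x s - x₀) ∈ interior 𝒳 :=
          interior_maximal h𝒳 (isOpen_lt hV continuous_const) hlt
        have hdist : dist (y + (x s - x₀)) x₀ < ρ := by
          have h1 : y + (x s - x₀) - x₀ = (y - x₀) + (x s - x₀) := by abel
          have h2 := norm_add_le (y - x₀) (x s - x₀)
          rw [dist_eq_norm] at hyd n1
          rw [dist_eq_norm, h1]
          linarith
        have hd : HasDerivWithinAt (fun s => y + (x s - x₀)) (f (x s) (x₀ - x s))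
            (Set.Ici s) s :=
          ((hx s ⟨hs2.1, hs2.2.trans_le hs₀.2⟩).sub_const x₀).const_add y
        have h1 := h (fun s => y + (x s - x₀)) s (x₀ - x s) (f (x s) (x₀ - x s)) hint n2 hdist n3 n4 hd
        obtain ⟨s', h2, h3⟩ := (h1.and (Ioc_mem_nhdsGT hb)).exists
        refine ⟨s', ?_, h3⟩
        rw [slope_def_field, div_lt_iff₀ (by linarith [h3.1])] at h2
        show V (y + (x s' - x₀)) + μ * s' ≤ V y
        linarith
    intro s hs
    have : V (y + (x s - x₀)) + μ * s ≤ V y := hsub hs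
    linarith
  intro s hs
  have hle : V (x s) ≤ V x₀ - μ * s := by
    have h1 : Tendsto (fun y => V (y + (x s - x₀))) (𝓝 x₀) (𝓝 (V (x s))) := by
      simpa using (show Continuous fun y => V (y + (x s - x₀)) by fun_prop).tendsto x₀
    refine le_of_tendsto_of_frequently h1 ?_
    exact ((mem_closure_iff_frequently.1 hcl).and_eventually
      (Metric.ball_mem_nhds x₀ (half_pos hρ))).mono fun y hy => key y hy.1 hy.2 s ⟨hs.1.le, hs.2⟩
  have := mul_pos hμ hs.1
  linarith

end Flow

/-! ### Decay of the Lyapunov function between samples -/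

section Flow

variable {np nc : ℕ} {f : XSpace np nc → XSpace np nc → XSpace np nc}
  {𝒳 ℰ : Set (XSpace np nc)} {V : XSpace np nc → ℝ} {ε γ L c : ℝ}

/-- The function `V + γ φ W²` has upper right Dini derivative at most `-ε (V + γ φ W²)`. The cross term
`2 γ φ W H` that comes from the bound on `W` is absorbed by completing a square with `-H²`. -/
theorem HybridLyapunov.exists_slope_add_lt (hf : Continuous fun p : _ × _ => f p.1 p.2)
    (hL : HybridLyapunov f 𝒳 ℰ V ε γ L) (h0 : (0 : XSpace np nc) ∈ ℰ) :
    ∃ W : XSpace np nc → ℝ, (∀ e ∈ ℰ, 0 ≤ W e) ∧ ContinuousOn W ℰ ∧ W 0 = 0 ∧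
      ∀ (x e : ℝ → XSpace np nc) (φ : ℝ → ℝ) (t Λ : ℝ), x t ∈ interior 𝒳 → e t ∈ interior ℰ →
      HasDerivWithinAt x (f (x t) (e t)) (Set.Ici t) t →
      HasDerivWithinAt e (-f (x t) (e t)) (Set.Ici t) t →
      0 ≤ φ t → HasDerivAt φ (-(γ + 2 * Λ * φ t + γ * φ t ^ 2)) t → L + ε / 2 ≤ Λ →
      ∀ r, -ε * (V (x t) + γ * φ t * W (e t) ^ 2) < r →
      ∀ᶠ s in 𝓝[>] t, slope (fun s => V (x s) + γ * φ s * W (e s) ^ 2) t s < r := by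
  obtain ⟨-, hγ, hVL, -, W, H, αW, αW', αV, αV', hWL, hW0, hH, hH0, -, hαW', -, -, hWb, -,
    hWd, hVd⟩ := hL
  refine ⟨W, hW0, hWL.continuousOn, ?_, ?_⟩
  · have := (hWb 0 h0).2
    simp [hαW'.map_zero] at this
    exact le_antisymm this (hW0 0 h0)
  intro x e φ t Λ hxt het hx he hφ0 hφ hΛ r hr
  have hXn : 𝒳 ∈ 𝓝 (x t) := mem_interior_iff_mem_nhds.1 hxt
  have hEn : ℰ ∈ 𝓝 (e t) := mem_interior_iff_mem_nhds.1 het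
  have hHat : ContinuousAt (fun p : XSpace np nc × XSpace np nc => H p.1 p.2) (x t, e t) :=
    hH.continuousAt (prod_mem_nhds hXn hEn)
  have hHx : ContinuousAt (fun y => H y (e t)) (x t) :=
    ContinuousAt.comp (f := fun y => (y, e t)) hHat (by fun_prop)
  have hHe : ContinuousAt (fun d => H (x t) d) (e t) :=
    ContinuousAt.comp (f := fun d => (x t, d)) hHat (by fun_prop)
  have hVc : ContinuousAt V (x t) := hVL.continuousOn.continuousAt hXn
  have hWc : ContinuousAt W (e t) := hWL.continuousOn.continuousAt hEn
  -- one-sided derivative bounds for `V` and `W` along the flow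
  have hVs : ∀ r, -ε * V (x t) - H (x t) (e t) ^ 2 + γ ^ 2 * W (e t) ^ 2 < r →
      ∀ᶠ s in 𝓝[>] t, slope (fun s => V (x s)) t s < r := by
    intro r hr
    obtain ⟨K, N, hN, hK⟩ := hVL (mem_of_mem_nhds hXn)
    rw [nhdsWithin_eq_nhds.2 hXn] at hN
    refine eventually_slope_comp_lt (volume : Measure (XSpace np nc)) (U := V) (K := K)
      (N := N ∩ 𝒳) (F := fun y => f y (e t))
      (P := fun y => -ε * V y - H y (e t) ^ 2 + γ ^ 2 * W (e t) ^ 2) (inter_mem hN hXn)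
      (hK.mono Set.inter_subset_left)
      (hf.comp (f := fun y : XSpace np nc => (y, e t)) (by fun_prop)).continuousAt
      (by fun_prop) ?_ hx (by simpa using hr)
    filter_upwards [hVd (e t) (mem_of_mem_nhds hEn)] with y hy hyN hyd using hy hyN.2 hyd
  have hWs : ∀ r, L * W (e t) + H (x t) (e t) < r →
      ∀ᶠ s in 𝓝[>] t, slope (fun s => W (e s)) t s < r := by
    intro r hr
    obtain ⟨K, N, hN, hK⟩ := hWL (mem_of_mem_nhds hEn)
    rw [nhdsWithin_eq_nhds.2 hEn] at hN
    refine eventually_slope_comp_lt (volume : Measure (XSpace np nc)) (U := W) (K := K)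
      (N := N ∩ ℰ) (F := fun d => -f (x t) d)
      (P := fun d => L * W d + H (x t) d) (inter_mem hN hEn)
      (hK.mono Set.inter_subset_left)
      (hf.comp (f := fun d : XSpace np nc => (x t, d)) (by fun_prop)).neg.continuousAt
      (by fun_prop) ?_ he (by simpa using hr)
    filter_upwards [hWd (x t) (mem_of_mem_nhds hXn)] with d hd hdN hdd using hd hdN.2 hdd
  have het' : Tendsto e (𝓝[>] t) (𝓝 (e t)) :=
    (he.continuousWithinAt.mono Set.Ioi_subset_Ici_self).tendsto
  have hWt : Tendsto (fun s => W (e s)) (𝓝[>] t) (𝓝 (W (e t))) := hWc.tendsto.comp het'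
  have hφs : Tendsto (slope φ t) (𝓝[>] t) (𝓝 (-(γ + 2 * Λ * φ t + γ * φ t ^ 2))) :=
    (hasDerivAt_iff_tendsto_slope.1 hφ).mono_left
      (nhdsWithin_mono _ fun s (hs : t < s) => hs.ne')
  have hWt0 : 0 ≤ W (e t) := hW0 _ (mem_of_mem_nhds hEn)
  set A := -ε * V (x t) - H (x t) (e t) ^ 2 + γ ^ 2 * W (e t) ^ 2 with hA
  set B := L * W (e t) + H (x t) (e t) with hB
  have hAB : (A + 0) + γ * (-(γ + 2 * Λ * φ t + γ * φ t ^ 2) * W (e t) ^ 2 +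
      φ t * ((W (e t) + W (e t)) * (B + 0))) < r := by
    refine lt_of_le_of_lt ?_ hr
    have h1 : 0 ≤ γ * φ t * W (e t) ^ 2 * (2 * Λ - 2 * L - ε) :=
      mul_nonneg (by positivity) (by linarith)
    nlinarith [sq_nonneg (H (x t) (e t) - γ * φ t * W (e t))]
  -- room for errors in the two one-sided bounds
  obtain ⟨κ, hκ, hκ0⟩ : ∃ κ : ℝ, (A + κ) + γ * (-(γ + 2 * Λ * φ t + γ * φ t ^ 2) * W (e t) ^ 2 +
      φ t * ((W (e t) + W (e t)) * (B + κ))) < r ∧ 0 < κ := by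
    have hc : Continuous fun κ : ℝ => (A + κ) + γ * (-(γ + 2 * Λ * φ t + γ * φ t ^ 2) *
      W (e t) ^ 2 + φ t * ((W (e t) + W (e t)) * (B + κ))) := by fun_prop
    exact ((((hc.tendsto 0).mono_left nhdsWithin_le_nhds).eventually_lt_const hAB).and
      (self_mem_nhdsWithin (s := Set.Ioi 0))).exists
  have hlim : Tendsto (fun s => (A + κ) + γ * (slope φ t s * W (e s) ^ 2 +
      φ t * ((W (e s) + W (e t)) * (B + κ)))) (𝓝[>] t) (𝓝 ((A + κ) +
      γ * (-(γ + 2 * Λ * φ t + γ * φ t ^ 2) * W (e t) ^ 2 +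
      φ t * ((W (e t) + W (e t)) * (B + κ))))) :=
    (((hφs.mul (hWt.pow 2)).add (((hWt.add_const _).mul_const _).const_mul _)).const_mul
      γ).const_add _
  filter_upwards [hlim.eventually_lt_const hκ, hVs (A + κ) (by linarith),
    hWs (B + κ) (by linarith), het'.eventually_mem hEn, self_mem_nhdsWithin]
    with s h1 h2 h3 h4 (h5 : t < s)
  refine lt_of_le_of_lt ?_ h1
  have h6 : slope (fun s => V (x s) + γ * φ s * W (e s) ^ 2) t s =
      slope (fun s => V (x s)) t s + γ * (slope φ t s * W (e s) ^ 2 +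
      φ t * ((W (e s) + W (e t)) * slope (fun s => W (e s)) t s)) := by
    have : s - t ≠ 0 := by linarith
    simp only [slope_def_field]
    field_simp
    ring
  rw [h6]
  have h7 := hW0 _ h4
  gcongr

/-- Exponential estimate for `V` between samples. The hypothesis `hsafe` says that the estimate itself
keeps `V` below the level `c`, so that the trajectory cannot leave the region where the
differential inequalities hold. -/
theorem le_exp_of_flow (hf : Continuous fun p : _ × _ => f p.1 p.2) (hV : Continuous V)
    (hc : 0 < c) (h𝒳 : {x | V x ≤ c} ⊆ 𝒳) (hℰ : ∀ y x, V y ≤ c → V x ≤ c → y - x ∈ ℰ)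
    (hcl : ∀ x, V x = c → x ∈ closure {y | V y < c})
    (hL : HybridLyapunov f 𝒳 ℰ V ε γ L) {Λ ℓ : ℝ} (hΛ : L + ε / 2 ≤ Λ) (hΛ0 : 0 < Λ)
    (hℓ : ℓ < Tmax γ Λ) {x : ℝ → XSpace np nc} (hxc : ContinuousOn x (Set.Icc 0 ℓ))
    (hx : ∀ s ∈ Set.Ico 0 ℓ, HasDerivWithinAt x (f (x s) (x 0 - x s)) (Set.Ici s) s)
    (h0 : V (x 0) ≤ c) (hsafe : ∀ s ∈ Set.Ioc 0 ℓ, Real.exp (-ε * s) * V (x 0) < c) :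
    ∀ s ∈ Set.Icc 0 ℓ, V (x s) ≤ Real.exp (-ε * s) * V (x 0) := by
  have hγ : 0 < γ := hL.2.1
  have hVnn : ∀ x ∈ 𝒳, 0 ≤ V x := hL.2.2.2.1
  have hopen : IsOpen {y | V y < c} := isOpen_lt hV continuous_const
  have h𝒳int : ∀ y, V y < c → y ∈ interior 𝒳 := fun y hy =>
    interior_maximal (fun z (hz : V z < c) => h𝒳 hz.le) hopen hy
  have hℰint : ∀ y z, V y ≤ c → V z < c → y - z ∈ interior ℰ := by
    intro y z hy hz
    have h1 : IsOpen ((fun w => y - w) '' {w | V w < c}) :=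
      (Homeomorph.subLeft y).isOpenMap _ hopen
    refine interior_maximal ?_ h1 ⟨z, hz, rfl⟩
    rintro _ ⟨w, hw, rfl⟩
    exact hℰ y w hy (le_of_lt hw)
  have hE0 : ℰ ∈ 𝓝 (0 : XSpace np nc) := by
    obtain ⟨z, hz⟩ : ∃ z, V z < c := by
      rcases h0.lt_or_eq with h | h
      · exact ⟨_, h⟩
      · exact closure_nonempty_iff.1 ⟨_, hcl _ h⟩
    have := hℰint z z hz.le hz
    rw [sub_self] at this
    exact mem_interior_iff_mem_nhds.1 this
  obtain ⟨φ, hφ⟩ := exists_riccati_of_lt_Tmax hγ hΛ0 hℓ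
  obtain ⟨W, hWnn, hWc, hW0, hslope⟩ := hL.exists_slope_add_lt hf (mem_of_mem_nhds hE0)
  -- the estimate holds as long as the level `c` has not been reached
  have hest : ∀ s ∈ Set.Ioc 0 ℓ, (∀ t ∈ Set.Ioo 0 s, V (x t) < c) →
      V (x s) ≤ Real.exp (-ε * s) * V (x 0) := by
    intro s hs hlt
    have hsub : Set.Icc 0 s ⊆ Set.Icc 0 ℓ := Set.Icc_subset_Icc_right hs.2
    have hxs : ContinuousOn x (Set.Icc 0 s) := hxc.mono hsub
    have hle : ∀ t ∈ Set.Icc 0 s, V (x t) ≤ c := by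
      intro t ht
      have h1 : ContinuousWithinAt (fun t => V (x t)) (Set.Ioo 0 s) t :=
        ((hV.comp_continuousOn hxs) t ht).mono Set.Ioo_subset_Icc_self
      exact ContinuousWithinAt.closure_le (by rwa [closure_Ioo hs.1.ne]) h1
        (continuousWithinAt_const (b := c)) fun u hu => (hlt u hu).le
    set U : ℝ → ℝ := fun t => V (x t) + γ * φ t * W (x 0 - x t) ^ 2 with hU
    have hUc : ContinuousOn U (Set.Icc 0 s) := by
      have h1 : ContinuousOn (fun t => W (x 0 - x t)) (Set.Icc 0 s) :=
        hWc.comp (continuousOn_const.sub hxs) fun t ht => hℰ _ _ h0 (hle t ht)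
      have h2 : ContinuousOn φ (Set.Icc 0 s) := fun t ht =>
        (hφ t (hsub ht)).2.continuousAt.continuousWithinAt
      have h3 : ContinuousOn (fun t => V (x t)) (Set.Icc 0 s) := hV.comp_continuousOn hxs
      exact h3.add ((continuousOn_const.mul h2).mul (h1.pow 2))
    have hgron : ∀ t ∈ Set.Ioo 0 s, U s ≤ U t * Real.exp (-ε * (s - t)) := by
      intro t ht
      have := le_gronwallBound_of_liminf_deriv_right_le (f := U) (f' := fun u => -ε * U u)
        (δ := U t) (K := -ε) (ε := 0) (a := t) (b := s)
        (hUc.mono (Set.Icc_subset_Icc_left ht.1.le)) ?_ le_rfl (fun u _ => by simp) s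
        ⟨ht.2.le, le_rfl⟩
      · rwa [gronwallBound_ε0] at this
      · intro u hu r hr
        have hu0 : u ∈ Set.Ioo 0 s := ⟨ht.1.trans_le hu.1, hu.2⟩
        have huI : u ∈ Set.Ico 0 ℓ := ⟨hu0.1.le, hu0.2.trans_le hs.2⟩
        have h1 := hslope x (fun t => x 0 - x t) φ u Λ (h𝒳int _ (hlt u hu0))
          (hℰint _ _ h0 (hlt u hu0)) (hx u huI) ((hx u huI).const_sub _)
          (hφ u ⟨huI.1, huI.2.le⟩).1 (hφ u ⟨huI.1, huI.2.le⟩).2 hΛ r hr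
        refine (h1.mono fun z hz => ?_).frequently
        rwa [slope_def_field, div_eq_inv_mul] at hz
    have hUs : V (x s) ≤ U s := by
      have := (hφ s ⟨hs.1.le, hs.2⟩).1
      simp only [hU]
      have : 0 ≤ γ * φ s * W (x 0 - x s) ^ 2 := by positivity
      linarith
    have hlim : Tendsto (fun t => U t * Real.exp (-ε * (s - t))) (𝓝[>] 0)
        (𝓝 (U 0 * Real.exp (-ε * (s - 0)))) := by
      have h1 : Tendsto U (𝓝[>] 0) (𝓝 (U 0)) := by
        have := (hUc 0 ⟨le_rfl, hs.1.le⟩).tendsto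
        rw [nhdsWithin_Icc_eq_nhdsGE hs.1] at this
        exact this.mono_left (nhdsWithin_mono _ Set.Ioi_subset_Ici_self)
      have h2 : Continuous fun t => Real.exp (-ε * (s - t)) := by fun_prop
      exact h1.mul ((h2.tendsto 0).mono_left nhdsWithin_le_nhds)
    have hU0 : U 0 = V (x 0) := by simp [hU, hW0]
    have := ge_of_tendsto hlim (by
      filter_upwards [Ioo_mem_nhdsGT hs.1] with t ht using hUs.trans (hgron t ht))
    rw [hU0, sub_zero] at this
    linarith
  intro s hs
  rcases hs.1.eq_or_lt with h | hspos
  · rw [← h]; simp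
  have hℓ0 : 0 < ℓ := hspos.trans_le hs.2
  -- the trajectory is below the level `c` right after the initial time
  obtain ⟨s₀, hs₀, hs₀lt⟩ : ∃ s₀ ∈ Set.Ioc 0 ℓ, ∀ t ∈ Set.Ioc 0 s₀, V (x t) < c := by
    rcases h0.lt_or_eq with h | h
    · have h1 : Tendsto (fun t => V (x t)) (𝓝[≥] 0) (𝓝 (V (x 0))) := by
        have := (hxc 0 ⟨le_rfl, hℓ0.le⟩).tendsto
        rw [nhdsWithin_Icc_eq_nhdsGE hℓ0] at this
        exact (hV.tendsto _).comp this
      obtain ⟨s₀, hs₀, hsub⟩ := (mem_nhdsGE_iff_exists_mem_Ioc_Ico_subset hℓ0).1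
        (h1.eventually_lt_const h)
      refine ⟨s₀ / 2, ⟨by linarith [hs₀.1], by linarith [hs₀.1, hs₀.2]⟩, fun t ht => ?_⟩
      exact hsub ⟨ht.1.le, by linarith [ht.2, hs₀.1]⟩
    · have hε : 0 < ε := by
        have h1 := hsafe ℓ ⟨hℓ0, le_rfl⟩
        rw [h] at h1
        have h2 : Real.exp (-ε * ℓ) < 1 := by nlinarith
        rw [Real.exp_lt_one_iff] at h2
        nlinarith
      have h1 := hL.exists_lt_of_flow hf hε hV hE0 (h𝒳 h.le) (h ▸ hc)
        (fun y hy => h𝒳 (le_of_lt (h ▸ hy : V y < c))) (by rw [h]; exact hcl _ h) hℓ0 rfl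
        hxc hx
      rwa [h] at h1
  have hall : ∀ t ∈ Set.Ioc 0 ℓ, V (x t) < c := by
    by_contra! hcon
    obtain ⟨t, ht, hct⟩ := hcon
    have hcomp : IsCompact {u ∈ Set.Icc s₀ ℓ | c ≤ V (x u)} := by
      have h1 : ContinuousOn (fun u => V (x u)) (Set.Icc s₀ ℓ) :=
        hV.comp_continuousOn (hxc.mono (Set.Icc_subset_Icc_left hs₀.1.le))
      exact isCompact_Icc.of_isClosed_subset
        (h1.preimage_isClosed_of_isClosed isClosed_Icc isClosed_Ici) (Set.sep_subset _ _)
    have hts : s₀ < t := by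
      by_contra! h
      exact absurd (hs₀lt t ⟨ht.1, h⟩) (not_lt.2 hct)
    obtain ⟨u, ⟨hu, hcu⟩, humin⟩ := hcomp.exists_isLeast ⟨t, ⟨hts.le, ht.2⟩, hct⟩
    have huI : u ∈ Set.Ioc 0 ℓ := ⟨hs₀.1.trans_le hu.1, hu.2⟩
    have h1 := hest u huI fun v hv => by
      rcases le_or_gt v s₀ with h | h
      · exact hs₀lt v ⟨hv.1, h⟩
      · by_contra! h2
        exact absurd (humin ⟨⟨h.le, hv.2.le.trans hu.2⟩, h2⟩) (not_le.2 hv.2)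
    exact absurd (h1.trans_lt (hsafe u huI)) (not_lt.2 hcu)
  exact hest s ⟨hspos, hs.2⟩ fun t ht => hall t ⟨ht.1, ht.2.le.trans hs.2⟩

end Flow

/-! ### The intervals selected by the mechanism -/

section Mechanism

theorem exp_mul_lt_of_pos {ε v c s : ℝ} (hc : 0 < c) (hv0 : 0 ≤ v) (hvc : v ≤ c) (hε : 0 < ε)
    (hs : 0 < s) : Real.exp (-ε * s) * v < c := by
  have h1 : Real.exp (-ε * s) < 1 := Real.exp_lt_one_iff.2 (by nlinarith)
  rcases hv0.eq_or_lt with h | h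
  · rw [← h]; simpa using hc
  · nlinarith

theorem candidate_le {δ εref ε γ L v C : ℝ}
    (hT : 0 ≤ δ * Tmax γ (max (L + ε / 2) (1 - δ))) :
    candidate δ εref ε γ L v C ≤ δ * Tmax γ (max (L + ε / 2) (1 - δ)) := by
  unfold candidate
  simp only
  split_ifs <;> simp [hT]

/-- A positive candidate interval keeps `V` below the level `c`, and at its end `V` has decayed at the
reference rate, relative to `max v C`. If `εref ≤ ε` this is due to the decay of `V` itself, and
otherwise to the logarithmic constraint. -/
theorem candidate_spec {δ εref ε γ L v C c : ℝ} (hεref : 0 < εref) (hc : 0 < c) (hv0 : 0 ≤ v)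
    (hvc : v ≤ c) (hC : C ≤ c) (hpos : 0 < candidate δ εref ε γ L v C) :
    (∀ s ∈ Set.Ioc 0 (candidate δ εref ε γ L v C), Real.exp (-ε * s) * v < c) ∧
    Real.exp (-ε * candidate δ εref ε γ L v C) * v ≤
      Real.exp (-εref * candidate δ εref ε γ L v C) * max v C := by
  set h := candidate δ εref ε γ L v C with hh
  -- parameter sets that decay at least as fast as the reference
  have hfast : εref ≤ ε → (∀ s ∈ Set.Ioc 0 h, Real.exp (-ε * s) * v < c) ∧
      Real.exp (-ε * h) * v ≤ Real.exp (-εref * h) * max v C := fun hle => by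
    refine ⟨fun s hs => exp_mul_lt_of_pos hc hv0 hvc (by linarith) hs.1, ?_⟩
    have h1 : -ε * h ≤ -εref * h := by nlinarith
    have := le_max_left v C
    gcongr
  by_cases hle : εref ≤ ε
  · exact hfast hle
  push Not at hle
  have hd : 0 < -ε + εref := by linarith
  unfold candidate at hh
  simp only [hd, hd.le, if_true] at hh
  have hvC : v ≤ C := by
    by_contra hcon
    rw [if_neg hcon] at hh
    linarith
  rw [if_pos hvC] at hh
  rcases hv0.eq_or_lt with h0 | h0
  · rw [← h0] at *
    simp only [mul_zero]
    exact ⟨fun _ _ => hc, by positivity⟩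
  · rw [if_neg h0.ne'] at hh
    have h1 : h ≤ (Real.log C - Real.log v) / (-ε + εref) := by rw [hh]; exact min_le_right _ _
    rw [le_div_iff₀ hd] at h1
    have hC0 : 0 < C := h0.trans_le hvC
    have key : ∀ s ≤ h, Real.exp (-ε * s) * v ≤ Real.exp (-εref * s) * C := by
      intro s hs
      have h2 : Real.exp (-ε * s) * v = Real.exp (-ε * s + Real.log v) := by
        rw [Real.exp_add, Real.exp_log h0]
      have h3 : Real.exp (-εref * s) * C = Real.exp (-εref * s + Real.log C) := by
        rw [Real.exp_add, Real.exp_log hC0]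
      rw [h2, h3, Real.exp_le_exp]
      nlinarith
    refine ⟨fun s hs => (key s hs.2).trans_lt
      (exp_mul_lt_of_pos hc hC0.le hC hεref hs.1), (key h le_rfl).trans ?_⟩
    have := le_max_right v C
    gcongr

theorem foldl_max_spec {α : Type*} (g : α → ℝ) (l : List α) (h₀ : ℝ) :
    h₀ ≤ l.foldl (fun h i => if h < g i then g i else h) h₀ ∧
    (l.foldl (fun h i => if h < g i then g i else h) h₀ = h₀ ∨
      ∃ i, l.foldl (fun h i => if h < g i then g i else h) h₀ = g i) := by
  induction l generalizing h₀ with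
  | nil => simp
  | cons a l ih =>
    simp only [List.foldl_cons]
    obtain ⟨h1, h2⟩ := ih (if h₀ < g a then g a else h₀)
    split_ifs at h1 h2 ⊢ with h3
    · exact ⟨h3.le.trans h1, Or.inr (h2.elim (fun h => ⟨a, h⟩) id)⟩
    · exact ⟨h1, h2⟩

variable {np nc n m : ℕ} {V : XSpace np nc → ℝ} {c δ εref : ℝ} {ε γ L : Fin (n + 1) → ℝ}

theorem fallback_pos {δ ε γ L : ℝ} (hδ : 0 < δ) (hγ : 0 < γ) (hL : 0 < L) (hε : 0 < ε) :
    0 < fallback δ ε γ L :=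
  mul_pos hδ (Tmax_pos hγ (by positivity))

theorem fallback_le_algorithmΓ (x : XSpace np nc) (η : EuclideanSpace ℝ (Fin (m - 1))) :
    fallback δ (ε 0) (γ 0) (L 0) ≤ algorithmΓ V c m δ εref ε γ L x η :=
  (foldl_max_spec _ _ _).1

/-- An upper bound for the sampling intervals. -/
noncomputable def maxInterval (δ : ℝ) (ε γ L : Fin (n + 1) → ℝ) : ℝ :=
  fallback δ (ε 0) (γ 0) (L 0) + ∑ i, δ * Tmax (γ i) (max (L i + ε i / 2) (1 - δ))

/-- The selected interval is bounded, and it is safe for one of the parameter sets. -/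
theorem algorithmΓ_spec (hδ0 : 0 < δ) (hδ1 : δ < 1) (hεref : 0 < εref) (hε : 0 < ε 0)
    (hγ : ∀ i, 0 < γ i) (hL : 0 < L 0) (hc : 0 < c) {x : XSpace np nc} (hv0 : 0 ≤ V x)
    (hvc : V x ≤ c) (η : EuclideanSpace ℝ (Fin (m - 1))) :
    algorithmΓ V c m δ εref ε γ L x η ≤ maxInterval δ ε γ L ∧
    ∃ i Λ, L i + ε i / 2 ≤ Λ ∧ 0 < Λ ∧ algorithmΓ V c m δ εref ε γ L x η < Tmax (γ i) Λ ∧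
      (∀ s ∈ Set.Ioc 0 (algorithmΓ V c m δ εref ε γ L x η), Real.exp (-ε i * s) * V x < c) ∧
      Real.exp (-ε i * algorithmΓ V c m δ εref ε γ L x η) * V x ≤
        Real.exp (-min εref (ε 0) * algorithmΓ V c m δ εref ε γ L x η) *
          max (V x) (windowBound V c m x η) := by
  have hfb := fallback_pos hδ0 (hγ 0) hL hε
  have hle := fallback_le_algorithmΓ (V := V) (c := c) (m := m) (δ := δ) (εref := εref)
    (ε := ε) (γ := γ) (L := L) x η
  have hΛ : ∀ i, 0 < max (L i + ε i / 2) (1 - δ) := fun i => lt_max_of_lt_right (by linarith)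
  have hT : ∀ i, 0 < Tmax (γ i) (max (L i + ε i / 2) (1 - δ)) := fun i => Tmax_pos (hγ i) (hΛ i)
  rcases (foldl_max_spec (fun i : Fin n => candidate δ εref (ε i.succ) (γ i.succ) (L i.succ) (V x)
    (windowBound V c m x η)) (List.finRange n) (fallback δ (ε 0) (γ 0) (L 0))).2 with h | ⟨i, h⟩
  · replace h : algorithmΓ V c m δ εref ε γ L x η = fallback δ (ε 0) (γ 0) (L 0) := h
    rw [h]
    constructor
    · have : 0 ≤ ∑ i, δ * Tmax (γ i) (max (L i + ε i / 2) (1 - δ)) :=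
        Finset.sum_nonneg fun i _ => (mul_pos hδ0 (hT i)).le
      unfold maxInterval; linarith
    · have hΛ0 : 0 < L 0 + ε 0 / 2 := by positivity
      refine ⟨0, L 0 + ε 0 / 2, le_rfl, hΛ0, ?_, fun s hs => exp_mul_lt_of_pos hc hv0 hvc hε hs.1,
        ?_⟩
      · have := Tmax_pos (hγ 0) hΛ0
        unfold fallback; nlinarith
      · have h1 : -ε 0 * fallback δ (ε 0) (γ 0) (L 0) ≤
            -min εref (ε 0) * fallback δ (ε 0) (γ 0) (L 0) := by
          have := min_le_right εref (ε 0)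
          nlinarith
        have := le_max_left (V x) (windowBound V c m x η)
        gcongr
  · replace h : algorithmΓ V c m δ εref ε γ L x η = candidate δ εref (ε i.succ) (γ i.succ)
      (L i.succ) (V x) (windowBound V c m x η) := h
    rw [h] at hle ⊢
    have hpos := hfb.trans_le hle
    have hCc : windowBound V c m x η ≤ c := min_le_left _ _
    have hcl := candidate_le (εref := εref) (v := V x) (C := windowBound V c m x η)
      (mul_pos hδ0 (hT i.succ)).le
    obtain ⟨h1, h2⟩ := candidate_spec hεref hc hv0 hvc hCc hpos
    constructor
    · have := Finset.single_le_sum (f := fun i => δ * Tmax (γ i) (max (L i + ε i / 2) (1 - δ)))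
        (fun i _ => (mul_pos hδ0 (hT i)).le) (Finset.mem_univ i.succ)
      unfold maxInterval
      linarith
    · refine ⟨i.succ, max (L i.succ + ε i.succ / 2) (1 - δ), le_max_left _ _, hΛ _, ?_, h1,
        h2.trans ?_⟩
      · have := hT i.succ
        nlinarith
      · have h3 : -εref * candidate δ εref (ε i.succ) (γ i.succ) (L i.succ) (V x)
            (windowBound V c m x η) ≤ -min εref (ε 0) * candidate δ εref (ε i.succ) (γ i.succ)
            (L i.succ) (V x) (windowBound V c m x η) := by
          have := min_le_left εref (ε 0)
          nlinarith
        have := hv0.trans (le_max_left (V x) (windowBound V c m x η))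
        exact mul_le_mul_of_nonneg_right (Real.exp_le_exp.2 h3) this

end Mechanism

/-! ### Hybrid time domains and phases of flow -/

section Hybrid

/-- The jump times up to a point `(T, J)` of the domain, with `T` put at the end of the list. -/
theorem IsHybridTimeDomain.exists_phases {dom : Set (ℝ × ℕ)} (hdom : IsHybridTimeDomain dom)
    {T : ℝ} {J : ℕ} (hT : (T, J) ∈ dom) :
    ∃ t : ℕ → ℝ, t 0 = 0 ∧ t (J + 1) = T ∧ (∀ j ≤ J, t j ≤ t (j + 1)) ∧
      ∀ j ≤ J, ∀ s ∈ Set.Icc (t j) (t (j + 1)), (s, j) ∈ dom := by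
  obtain ⟨J', t, ht0, htm, hE⟩ := hdom.truncation _ hT
  have hmem : ∀ q : ℝ × ℕ, (q ∈ dom ∧ 0 ≤ q.1 ∧ q.1 ≤ T ∧ q.2 ≤ J) ↔
      (q.2 < J' ∧ t q.2 ≤ q.1 ∧ q.1 ≤ t (q.2 + 1)) := fun q => Set.ext_iff.1 hE q
  obtain ⟨hJ, hJ1, hJ2⟩ := (hmem (T, J)).1 ⟨hT, hdom.nonneg _ hT, le_rfl, le_rfl⟩
  simp only at hJ hJ1 hJ2
  have hmono : ∀ j ≤ J, t j ≤ t (j + 1) := fun j hj => htm j (hj.trans_lt hJ)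
  refine ⟨t, ht0, le_antisymm ?_ hJ2, hmono, fun j hj s hs => ?_⟩
  · exact ((hmem (t (J + 1), J)).2 ⟨hJ, hmono J le_rfl, le_rfl⟩).2.2.1
  · exact ((hmem (s, j)).2 ⟨hj.trans_lt hJ, hs.1, hs.2⟩).1

theorem IsHybridTimeDomain.le_of_consecutive_jumps {dom : Set (ℝ × ℕ)}
    (hdom : IsHybridTimeDomain dom) {s s' : ℝ} {j : ℕ} (h1 : (s, j) ∈ dom)
    (h2 : (s, j + 1) ∈ dom) (h3 : (s', j + 1) ∈ dom) :
    s ≤ s' ∧ ∀ u ∈ Set.Icc s s', (u, j + 1) ∈ dom := by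
  have hle : s ≤ s' := by
    by_contra! hlt
    obtain ⟨J', t, ht0, htm, hE⟩ := hdom.truncation _ h2
    have hmem : ∀ q : ℝ × ℕ, (q ∈ dom ∧ 0 ≤ q.1 ∧ q.1 ≤ s ∧ q.2 ≤ j + 1) ↔
        (q.2 < J' ∧ t q.2 ≤ q.1 ∧ q.1 ≤ t (q.2 + 1)) := fun q => Set.ext_iff.1 hE q
    have h4 := ((hmem (s, j)).1 ⟨h1, hdom.nonneg _ h1, le_rfl, by simp⟩).2.2
    have h5 := ((hmem (s', j + 1)).1 ⟨h3, hdom.nonneg _ h3, hlt.le, le_rfl⟩).2.1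
    simp only at h4 h5
    linarith
  refine ⟨hle, fun u hu => ?_⟩
  obtain ⟨J', t, ht0, htm, hE⟩ := hdom.truncation _ h3
  have hmem : ∀ q : ℝ × ℕ, (q ∈ dom ∧ 0 ≤ q.1 ∧ q.1 ≤ s' ∧ q.2 ≤ j + 1) ↔
      (q.2 < J' ∧ t q.2 ≤ q.1 ∧ q.1 ≤ t (q.2 + 1)) := fun q => Set.ext_iff.1 hE q
  have h4 := (hmem (s, j + 1)).1 ⟨h2, hdom.nonneg _ h2, hle, le_rfl⟩
  have h5 := (hmem (s', j + 1)).1 ⟨h3, hdom.nonneg _ h3, le_rfl, le_rfl⟩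
  exact ((hmem (u, j + 1)).2 ⟨h4.1, h4.2.1.trans hu.1, hu.2.trans h5.2.2⟩).1

/-- If the flow map is continuous, solutions are differentiable from the right at every time. -/
theorem HybridSystem.IsSolution.continuousOn_hasDerivWithinAt {E : Type} [NormedAddCommGroup E]
    [NormedSpace ℝ E] [CompleteSpace E] {sys : HybridSystem E} (hF : Continuous sys.F)
    {dom : Set (ℝ × ℕ)} {ξ : ℝ → ℕ → E} (hξ : sys.IsSolution dom ξ) {j : ℕ} {a b : ℝ}
    (hab : a ≤ b) (hmem : ∀ t ∈ Set.Icc a b, (t, j) ∈ dom) :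
    ContinuousOn (fun t => ξ t j) (Set.Icc a b) ∧
    ∀ t ∈ Set.Ico a b, HasDerivWithinAt (fun s => ξ s j) (sys.F (ξ t j)) (Set.Ici t) t := by
  have hac := hξ.absolutelyContinuous j a b hab (hmem a ⟨le_rfl, hab⟩) (hmem b ⟨hab, le_rfl⟩)
  have hc : ContinuousOn (fun t => ξ t j) (Set.Icc a b) := by
    rw [← Set.uIcc_of_le hab]; exact hac.continuousOn
  refine ⟨hc, ?_⟩
  -- the trajectory is the primitive of the continuous function `sys.F (ξ t j)`
  set g : ℝ → E := Set.IccExtend hab (Set.domRestrict (Set.Icc a b) fun t => sys.F (ξ t j)) with hg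
  have hgc : Continuous g := (hF.comp_continuousOn hc).domRestrict.Icc_extend'
  have hgeq : ∀ t ∈ Set.Icc a b, g t = sys.F (ξ t j) := fun t ht => by
    rw [hg, Set.IccExtend_of_mem hab _ ht]; rfl
  set G : ℝ → E := fun t => ∫ s in a..t, g s with hG
  have hGd : ∀ t, HasDerivAt G (g t) t := fun t =>
    intervalIntegral.integral_hasDerivAt_right (hgc.intervalIntegrable _ _)
      (hgc.stronglyMeasurableAtFilter _ _) hgc.continuousAt
  have hGac : AbsolutelyContinuousOnInterval G a b := by
    apply ContDiffOn.absolutelyContinuousOnInterval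
    apply ContDiff.contDiffOn
    rw [contDiff_one_iff_deriv]
    exact ⟨fun t => (hGd t).differentiableAt, by
      rw [show deriv G = g from funext fun t => (hGd t).deriv]; exact hgc⟩
  obtain ⟨K, hK⟩ := (hac.sub hGac).const_of_ae_hasDerivAt_zero (by
    filter_upwards [hξ.flow j] with t ht htI
    rw [Set.uIcc_of_le hab] at htI
    have h1 := (ht (hmem t htI)).2.sub (hGd t)
    rwa [hgeq t htI, sub_self] at h1)
  rw [Set.uIcc_of_le hab] at hK
  have heq : ∀ t ∈ Set.Icc a b, ξ t j = K + G t := fun t ht => by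
    rw [← hK t ht]; simp
  intro t ht
  have h1 : HasDerivWithinAt (fun s => K + G s) (sys.F (ξ t j)) (Set.Ici t) t := by
    rw [← hgeq t ⟨ht.1, ht.2.le⟩]
    exact ((hGd t).const_add K).hasDerivWithinAt
  refine h1.congr_of_eventuallyEq ?_ (heq t ⟨ht.1, ht.2.le⟩)
  filter_upwards [Icc_mem_nhdsGE ht.2] with s hs using heq s ⟨ht.1.trans hs.1, hs.2⟩

variable {np nc nη : ℕ} {f : XSpace np nc → XSpace np nc → XSpace np nc}
  {S : EuclideanSpace ℝ (Fin nη) → XSpace np nc → EuclideanSpace ℝ (Fin nη)}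
  {Γ : XSpace np nc → EuclideanSpace ℝ (Fin nη) → ℝ}

theorem continuous_hybridLoop_F (hf : Continuous fun p : XSpace np nc × XSpace np nc => f p.1 p.2) :
    Continuous (hybridLoop f S Γ).F := by
  have h : Continuous fun ξ : HState np nc nη => f ξ.1 ξ.2.1 :=
    hf.comp (f := fun ξ : HState np nc nη => (ξ.1, ξ.2.1)) (by fun_prop)
  exact h.prodMk (h.neg.prodMk continuous_const)

/-- During a phase of flow `x + e`, `η` and `h` are constant and `τ` measures the elapsed time. -/
theorem hybridLoop_phase (hf : Continuous fun p : XSpace np nc × XSpace np nc => f p.1 p.2)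
    {dom : Set (ℝ × ℕ)} {ξ : ℝ → ℕ → HState np nc nη}
    (hξ : (hybridLoop f S Γ).IsSolution dom ξ) {j : ℕ} {a b : ℝ} (hab : a ≤ b)
    (hmem : ∀ t ∈ Set.Icc a b, (t, j) ∈ dom) :
    ContinuousOn (fun t => HState.x (ξ t j)) (Set.Icc a b) ∧
    (∀ t ∈ Set.Ico a b, HasDerivWithinAt (fun s => HState.x (ξ s j))
      (f (HState.x (ξ t j)) (HState.e (ξ t j))) (Set.Ici t) t) ∧
    ∀ t ∈ Set.Icc a b, HState.x (ξ t j) + HState.e (ξ t j) = HState.x (ξ a j) + HState.e (ξ a j) ∧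
      HState.η (ξ t j) = HState.η (ξ a j) ∧ HState.τ (ξ t j) = HState.τ (ξ a j) + (t - a) ∧
      HState.h (ξ t j) = HState.h (ξ a j) := by
  obtain ⟨hc, hd⟩ := hξ.continuousOn_hasDerivWithinAt (continuous_hybridLoop_F hf) hab hmem
  let p₁ : HState np nc nη →L[ℝ] XSpace np nc := ContinuousLinearMap.fst ℝ (XSpace np nc) _
  let p₂ : HState np nc nη →L[ℝ] XSpace np nc :=
    (ContinuousLinearMap.fst ℝ (XSpace np nc) _).comp (ContinuousLinearMap.snd ℝ (XSpace np nc) _)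
  let p₃ : HState np nc nη →L[ℝ] EuclideanSpace ℝ (Fin nη) × ℝ × ℝ :=
    (ContinuousLinearMap.snd ℝ (XSpace np nc) _).comp (ContinuousLinearMap.snd ℝ (XSpace np nc) _)
  refine ⟨continuous_fst.comp_continuousOn hc, fun t ht =>
    p₁.hasFDerivAt.comp_hasDerivWithinAt t (hd t ht), ?_⟩
  let P : HState np nc nη →L[ℝ] XSpace np nc × EuclideanSpace ℝ (Fin nη) × ℝ × ℝ :=
    (p₁ + p₂).prod p₃
  have hconst := constant_of_has_deriv_right_zero (f := fun t => P (ξ t j) - t • (0, 0, 1, 0))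
    (a := a) (b := b) (by fun_prop) (fun t ht => by
      refine ((P.hasFDerivAt.comp_hasDerivWithinAt t (hd t ⟨ht.1, ht.2⟩)).sub
        ((hasDerivAt_id t).smul_const _).hasDerivWithinAt).congr_deriv ?_
      simp [hybridLoop, P, p₁, p₂, p₃])
  intro t ht
  have := hconst t ht
  simp [P, p₁, p₂, p₃, Prod.ext_iff] at this
  obtain ⟨h1, h2, h3, h4⟩ := this
  refine ⟨h1, h2, ?_, h4⟩
  simp only [HState.τ]
  linarith

/-- A phase of positive length cannot flow out of `{τ ≤ h}`. -/
theorem hybridLoop_elapsed_le (hf : Continuous fun p : XSpace np nc × XSpace np nc => f p.1 p.2)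
    {dom : Set (ℝ × ℕ)} {ξ : ℝ → ℕ → HState np nc nη}
    (hξ : (hybridLoop f S Γ).IsSolution dom ξ) {j : ℕ} {a b : ℝ} (hab : a < b)
    (hmem : ∀ t ∈ Set.Icc a b, (t, j) ∈ dom) :
    HState.τ (ξ a j) + (b - a) ≤ HState.h (ξ a j) := by
  have hphase := (hybridLoop_phase hf hξ hab.le hmem).2.2
  by_contra! hcon
  have hlt : max a (HState.h (ξ a j) - HState.τ (ξ a j) + a) < b :=
    max_lt hab (by linarith)
  obtain ⟨t, ht1, ht2⟩ := (Measure.dense_of_ae (hξ.flow j)).exists_mem_open isOpen_Ioo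
    (Set.nonempty_Ioo.2 hlt)
  have htI : t ∈ Set.Icc a b := ⟨(le_max_left _ _).trans ht2.1.le, ht2.2.le⟩
  have hC : HState.τ (ξ t j) ≤ HState.h (ξ t j) := (ht1 (hmem t htI)).1
  obtain ⟨-, -, h3, h4⟩ := hphase t htI
  have := (le_max_right a (HState.h (ξ a j) - HState.τ (ξ a j) + a)).trans_lt ht2.1
  linarith

theorem interSamplingAtLeast_of_le
    (hf : Continuous fun p : XSpace np nc × XSpace np nc => f p.1 p.2) {tmin : ℝ}
    (hΓ : ∀ x η, tmin ≤ Γ x η) : InterSamplingAtLeast (hybridLoop f S Γ) tmin := by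
  intro dom ξ hξ _ j s s' h1 h2 h3 h4
  obtain ⟨hle, hmem⟩ := hξ.domain.le_of_consecutive_jumps h1 h2 h3
  obtain ⟨-, -, hτ, hh⟩ := (hybridLoop_phase hf hξ hle hmem).2.2 s' ⟨hle, le_rfl⟩
  have hD : HState.τ (ξ s' (j + 1)) = HState.h (ξ s' (j + 1)) := (hξ.jump s' (j + 1) h3 h4).1
  have hG := (hξ.jump s j h1 h2).2
  have h5 : HState.τ (ξ s (j + 1)) = 0 := by rw [hG]; rfl
  have h6 : HState.h (ξ s (j + 1)) = Γ (HState.x (ξ s j)) (HState.η (ξ s j)) := by rw [hG]; rfl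
  have := hΓ (HState.x (ξ s j)) (HState.η (ξ s j))
  linarith

end Hybrid

/-! ### Comparison functions and the sliding window -/

section Comparison

/-- The inverse of a class `𝒦_∞` function. -/
theorem ClassKInf.exists_inverse {α : ℝ≥0 → ℝ≥0} (hα : ClassKInf α) :
    ∃ ψ : ℝ≥0 → ℝ≥0, ClassK ψ ∧ ∀ x y, α x ≤ y → x ≤ ψ y := by
  have hsurj : Function.Surjective α := fun y => by
    obtain ⟨s, hs⟩ := hα.unbounded y
    obtain ⟨x, -, hx⟩ := intermediate_value_Icc (zero_le (a := s)) hα.continuous.continuousOn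
      ⟨hα.map_zero.trans_le (zero_le (a := y)), hs.le⟩
    exact ⟨x, hx⟩
  let e := hα.strictMono.orderIsoOfSurjective α hsurj
  refine ⟨e.symm, ⟨e.symm.continuous, e.symm.strictMono, ?_⟩, fun x y h => ?_⟩
  · rw [e.symm_apply_eq]; exact hα.map_zero.symm
  · exact (e.le_symm_apply).2 h

/-- The decaying exponential `exp (-a t)`. -/
noncomputable def expDecay (a : ℝ) (t : ℝ≥0) : ℝ≥0 := Real.toNNReal (Real.exp (-(a * t)))

theorem coe_expDecay (a : ℝ) (t : ℝ≥0) : (expDecay a t : ℝ) = Real.exp (-(a * t)) :=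
  Real.coe_toNNReal _ (Real.exp_pos _).le

theorem expDecay_pos (a : ℝ) (t : ℝ≥0) : 0 < expDecay a t := Real.toNNReal_pos.2 (Real.exp_pos _)

theorem continuous_expDecay (a : ℝ) : Continuous (expDecay a) := by unfold expDecay; fun_prop

theorem antitone_expDecay {a : ℝ} (ha : 0 < a) : Antitone (expDecay a) := fun s t hst => by
  apply Real.toNNReal_le_toNNReal
  have : (s : ℝ) ≤ t := hst
  rw [Real.exp_le_exp]
  nlinarith

theorem tendsto_expDecay {a : ℝ} (ha : 0 < a) : Tendsto (expDecay a) atTop (𝓝 0) := by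
  rw [← NNReal.tendsto_coe]
  simp only [coe_expDecay, NNReal.coe_zero]
  refine Real.tendsto_exp_atBot.comp (tendsto_neg_atTop_atBot.comp ?_)
  exact (NNReal.tendsto_coe_atTop.2 tendsto_id).const_mul_atTop ha

/-- If the time between jumps is at most `M`, a bound that decays in the number of jumps also decays in
time. -/
theorem expDecay_one_pow_le {κ M T : ℝ} {j : ℕ} (hκ : 0 < κ) (hM : 0 < M) (hT : 0 ≤ T)
    (hTle : T ≤ (j + 1) * M) :
    expDecay κ 1 ^ j ≤ (expDecay κ 1)⁻¹ * (expDecay (κ / (2 * M)) T.toNNReal *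
      expDecay (κ / 2) ((j + 1 : ℕ) : ℝ≥0)) := by
  have h : κ / (2 * M) * T ≤ κ / 2 * (j + 1) := by
    rw [div_mul_eq_mul_div, div_le_iff₀ (by positivity)]
    have := mul_le_mul_of_nonneg_left hTle hκ.le
    linarith
  rw [← NNReal.coe_le_coe]
  simp only [NNReal.coe_pow, NNReal.coe_mul, NNReal.coe_inv, coe_expDecay,
    Real.coe_toNNReal _ hT, ← Real.exp_nat_mul, ← Real.exp_neg, ← Real.exp_add, Real.exp_le_exp]
  push_cast
  linarith

theorem ClassK.mul_const {B : ℝ≥0 → ℝ≥0} (hB : ClassK B) {k : ℝ≥0} (hk : 0 < k) :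
    ClassK fun q => B q * k where
  continuous := hB.continuous.mul continuous_const
  strictMono := fun _ _ h => mul_lt_mul_of_pos_right (hB.strictMono h) hk
  map_zero := by simp [hB.map_zero]

theorem ClassK.comp {A B : ℝ≥0 → ℝ≥0} (hA : ClassK A) (hB : ClassK B) :
    ClassK fun q => A (B q) where
  continuous := hA.continuous.comp hB.continuous
  strictMono := hA.strictMono.comp hB.strictMono
  map_zero := by simp [hB.map_zero, hA.map_zero]

theorem ClassK.add {A B : ℝ≥0 → ℝ≥0} (hA : ClassK A) (hB : ClassK B) :
    ClassK fun q => A q + B q where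
  continuous := hA.continuous.add hB.continuous
  strictMono := hA.strictMono.add hB.strictMono
  map_zero := by simp [hB.map_zero, hA.map_zero]

theorem classK_id : ClassK fun q => q := ⟨continuous_id, strictMono_id, rfl⟩

theorem classKL_expDecay {Ψ B : ℝ≥0 → ℝ≥0} (hΨ : ClassK Ψ) (hB : ClassK B) {a : ℝ} (ha : 0 < a) :
    ClassKL fun q t => Ψ (B q * expDecay a t) where
  continuous := hΨ.continuous.comp
    ((hB.continuous.comp continuous_fst).mul ((continuous_expDecay a).comp continuous_snd))
  classK := fun t => hΨ.comp (hB.mul_const (expDecay_pos a t))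
  antitone := fun q s t hst => hΨ.strictMono.monotone (by
    have := antitone_expDecay ha hst
    gcongr)
  tendsto_zero := fun q => by
    have h := (hΨ.continuous.tendsto (B q * 0)).comp ((tendsto_expDecay ha).const_mul (B q))
    rwa [mul_zero, hΨ.map_zero] at h

theorem classKLL_expDecay {Ψ B : ℝ≥0 → ℝ≥0} (hΨ : ClassK Ψ) (hB : ClassK B) {a b : ℝ} (ha : 0 < a)
    (hb : 0 < b) : ClassKLL fun q t j => Ψ (B q * expDecay a t * expDecay b j) where
  left := fun r => classKL_expDecay hΨ (hB.mul_const (expDecay_pos a r)) hb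
  right := fun r => by
    simp only [mul_right_comm _ _ (expDecay b r)]
    exact classKL_expDecay hΨ (hB.mul_const (expDecay_pos b r)) ha

end Comparison

section Window

variable {np nc m : ℕ} {V : XSpace np nc → ℝ} {c : ℝ}

theorem windowBound_le (hm : 1 ≤ m) {x : XSpace np nc} {η : EuclideanSpace ℝ (Fin (m - 1))} {B : ℝ}
    (hx : V x ≤ B) (hη : ∀ i, |η i| ≤ B) : windowBound V c m x η ≤ B := by
  refine (min_le_right _ _).trans ?_
  have hm0 : (0 : ℝ) < m := by exact_mod_cast hm
  rw [div_le_iff₀ hm0]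
  have h1 : ∑ i, η i ≤ ∑ _i : Fin (m - 1), B :=
    Finset.sum_le_sum fun i _ => (le_abs_self _).trans (hη i)
  rw [Finset.sum_const, Finset.card_univ, Fintype.card_fin, nsmul_eq_mul, Nat.cast_sub hm] at h1
  push_cast at h1
  linarith

/-- Up to a shift, the exponent `j + i` is the number of the sample that produced the entry `η i` present
at sample `j`; the update moves entries by one place, which keeps their exponents. -/
theorem abs_windowUpdate_le {A lam : ℝ} {j : ℕ} {x : XSpace np nc}
    {η : EuclideanSpace ℝ (Fin (m - 1))} (hx0 : 0 ≤ V x) (hx : V x ≤ A * lam ^ (j + (m - 1)))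
    (hη : ∀ i, |η i| ≤ A * lam ^ (j + i.val)) (i : Fin (m - 1)) :
    |windowUpdate V m η x i| ≤ A * lam ^ (j + 1 + i.val) := by
  simp only [windowUpdate]
  split_ifs with h
  · have := hη ⟨i.val + 1, h⟩
    rwa [show j + (i.val + 1) = j + 1 + i.val by omega] at this
  · rw [abs_of_nonneg hx0, show j + 1 + i.val = j + (m - 1) by omega]
    exact hx

end Window

section Norm

variable {np nc nη : ℕ}

theorem stackedNorm_le (ξ : HState np nc nη) :
    stackedNorm ξ ≤ ‖HState.x ξ‖₊ + ‖HState.e ξ‖₊ + ‖HState.η ξ‖₊ := by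
  unfold stackedNorm
  rw [NNReal.sqrt_le_iff_le_sq]
  have : ∀ a b d : ℝ≥0, a ^ 2 + b ^ 2 + d ^ 2 ≤ (a + b + d) ^ 2 := fun a b d => by
    rw [show (a + b + d) ^ 2 = a ^ 2 + b ^ 2 + d ^ 2 + (2 * a * b + 2 * a * d + 2 * b * d) by ring]
    exact le_self_add
  exact this _ _ _

theorem nnnorm_x_le_stackedNorm (ξ : HState np nc nη) : ‖HState.x ξ‖₊ ≤ stackedNorm ξ := by
  unfold stackedNorm
  rw [NNReal.le_sqrt_iff_sq_le, add_assoc]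
  exact le_self_add

theorem nnnorm_η_le_stackedNorm (ξ : HState np nc nη) : ‖HState.η ξ‖₊ ≤ stackedNorm ξ := by
  unfold stackedNorm
  rw [NNReal.le_sqrt_iff_sq_le]
  exact le_add_self

theorem norm_le_mul_of_abs_le {k : ℕ} {η : EuclideanSpace ℝ (Fin k)} {B : ℝ}
    (h : ∀ i, |η i| ≤ B) : ‖η‖ ≤ k * B := by
  rcases k.eq_zero_or_pos with rfl | hk
  · simp [Subsingleton.elim η 0]
  have hB : 0 ≤ B := (abs_nonneg _).trans (h ⟨0, hk⟩)
  have hk1 : (1 : ℝ) ≤ k := by exact_mod_cast hk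
  refine abs_le_of_sq_le_sq' ?_ (by positivity) |>.2
  rw [EuclideanSpace.real_norm_sq_eq]
  calc ∑ i, η i ^ 2 ≤ ∑ _i : Fin k, B ^ 2 := Finset.sum_le_sum fun i _ => sq_le_sq' (by
        have := abs_le.1 (h i); linarith) ((le_abs_self _).trans (h i))
    _ = k * B ^ 2 := by simp
    _ ≤ (k * B) ^ 2 := by
        rw [mul_pow]
        exact mul_le_mul_of_nonneg_right (by nlinarith) (sq_nonneg B)

end Norm

/-! ### Stability of the sampled-data loop -/

section Stability

variable {np nc n m : ℕ} {f : XSpace np nc → XSpace np nc → XSpace np nc}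
  {𝒳 ℰ : Set (XSpace np nc)} {V : XSpace np nc → ℝ} {c δ εref : ℝ} {ε γ L : Fin (n + 1) → ℝ}

/-- The assumptions on the data `f`, `V`, `c` and on the parameters of the mechanism, with the
condition on the points at level `c` in the form `{V = c} ⊆ closure {V < c}`. -/
structure StandingAssumptions (f : XSpace np nc → XSpace np nc → XSpace np nc)
    (𝒳 ℰ : Set (XSpace np nc)) (V : XSpace np nc → ℝ) (c δ εref : ℝ) (m : ℕ)
    (ε γ L : Fin (n + 1) → ℝ) : Prop where
  continuous_f : Continuous fun p : XSpace np nc × XSpace np nc => f p.1 p.2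
  continuous_V : Continuous V
  c_pos : 0 < c
  sublevel_subset : {x | V x ≤ c} ⊆ 𝒳
  sub_mem : ∀ y x, V y ≤ c → V x ≤ c → y - x ∈ ℰ
  mem_closure : ∀ x, V x = c → x ∈ closure {y | V y < c}
  lyapunov : ∀ i, HybridLyapunov f 𝒳 ℰ V (ε i) (γ i) (L i)
  ε_pos : 0 < ε 0
  one_le_m : 1 ≤ m
  δ_pos : 0 < δ
  δ_lt_one : δ < 1
  εref_pos : 0 < εref

/-- The hybrid closed loop under the self-triggered mechanism. -/
noncomputable abbrev loop (f : XSpace np nc → XSpace np nc → XSpace np nc)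
    (V : XSpace np nc → ℝ) (c δ εref : ℝ) (m : ℕ) (ε γ L : Fin (n + 1) → ℝ) :
    HybridSystem (HState np nc (m - 1)) :=
  hybridLoop f (windowUpdate V m) (algorithmΓ V c m δ εref ε γ L)

/-- A bound for the factor by which `V` can grow between two samples. -/
noncomputable def growth (δ : ℝ) (ε γ L : Fin (n + 1) → ℝ) : ℝ :=
  Real.exp ((∑ i, |ε i|) * maxInterval δ ε γ L)

/-- The factor by which `V` drops below the maximum of the preceding window, per sample. -/
noncomputable def sampleDecay (δ εref : ℝ) (ε γ L : Fin (n + 1) → ℝ) : ℝ :=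
  Real.exp (-(min εref (ε 0) * fallback δ (ε 0) (γ 0) (L 0)))

namespace StandingAssumptions

theorem V_nonneg (hA : StandingAssumptions f 𝒳 ℰ V c δ εref m ε γ L) {x : XSpace np nc}
    (hx : V x ≤ c) : 0 ≤ V x := (hA.lyapunov 0).2.2.2.1 x (hA.sublevel_subset hx)

theorem fallback_pos (hA : StandingAssumptions f 𝒳 ℰ V c δ εref m ε γ L) :
    0 < fallback δ (ε 0) (γ 0) (L 0) :=
  DynSTC.fallback_pos hA.δ_pos (hA.lyapunov 0).2.1 (hA.lyapunov 0).1 hA.ε_pos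

/-- One phase of flow, started by a jump at time `a`; the last claim concerns complete phases, which end
in another jump. -/
theorem phase_estimate (hA : StandingAssumptions f 𝒳 ℰ V c δ εref m ε γ L) {dom : Set (ℝ × ℕ)}
    {ξ : ℝ → ℕ → HState np nc (m - 1)} (hξ : (loop f V c δ εref m ε γ L).IsSolution dom ξ)
    {j : ℕ} {a b : ℝ} (hab : a ≤ b) (haj : (a, j) ∈ dom)
    (hmem : ∀ t ∈ Set.Icc a b, (t, j + 1) ∈ dom) (hVc : V (HState.x (ξ a j)) ≤ c) :
    b - a ≤ maxInterval δ ε γ L ∧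
    V (HState.x (ξ b (j + 1))) ≤ growth δ ε γ L * V (HState.x (ξ a j)) ∧
    V (HState.x (ξ b (j + 1))) ≤ c ∧
    HState.x (ξ b (j + 1)) + HState.e (ξ b (j + 1)) = HState.x (ξ a j) ∧
    HState.η (ξ b (j + 1)) = windowUpdate V m (HState.η (ξ a j)) (HState.x (ξ a j)) ∧
    ((b, j + 2) ∈ dom → V (HState.x (ξ b (j + 1))) ≤ sampleDecay δ εref ε γ L *
      max (V (HState.x (ξ a j))) (windowBound V c m (HState.x (ξ a j)) (HState.η (ξ a j)))) := by
  have hf := hA.continuous_f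
  have hG := (hξ.jump a j haj (hmem a ⟨le_rfl, hab⟩)).2
  have hfb := hA.fallback_pos
  have hfbΓ := fallback_le_algorithmΓ (V := V) (c := c) (m := m) (δ := δ) (εref := εref)
    (ε := ε) (γ := γ) (L := L) (HState.x (ξ a j)) (HState.η (ξ a j))
  obtain ⟨hmax, i, Λ, hΛ, hΛ0, hlt, hsafe, hend⟩ := algorithmΓ_spec (V := V) (m := m) (ε := ε)
    (γ := γ) (L := L) hA.δ_pos hA.δ_lt_one hA.εref_pos hA.ε_pos (fun i => (hA.lyapunov i).2.1)
    (hA.lyapunov 0).1 hA.c_pos (hA.V_nonneg hVc) hVc (HState.η (ξ a j))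
  have hxa : HState.x (ξ a (j + 1)) = HState.x (ξ a j) := by rw [hG]; rfl
  have hea : HState.e (ξ a (j + 1)) = 0 := by rw [hG]; rfl
  have hηa : HState.η (ξ a (j + 1)) = windowUpdate V m (HState.η (ξ a j)) (HState.x (ξ a j)) := by
    rw [hG]; rfl
  have hτa : HState.τ (ξ a (j + 1)) = 0 := by rw [hG]; rfl
  have hha : HState.h (ξ a (j + 1)) =
      algorithmΓ V c m δ εref ε γ L (HState.x (ξ a j)) (HState.η (ξ a j)) := by rw [hG]; rfl
  have hv0 := hA.V_nonneg hVc
  set x₀ := HState.x (ξ a j) with hx₀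
  set η₀ := HState.η (ξ a j) with hη₀
  set h := algorithmΓ V c m δ εref ε γ L x₀ η₀ with hh
  obtain ⟨hxc, hxd, hcons⟩ := hybridLoop_phase hf hξ hab hmem
  have hlen : b - a ≤ h := by
    rcases hab.eq_or_lt with hab' | hab'
    · linarith
    · have := hybridLoop_elapsed_le hf hξ hab' hmem
      linarith
  -- the flow estimate, in the time elapsed since the last sample
  have hflow := le_exp_of_flow (x := fun s => HState.x (ξ (a + s) (j + 1))) hf hA.continuous_V
    hA.c_pos hA.sublevel_subset hA.sub_mem hA.mem_closure (hA.lyapunov i) hΛ hΛ0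
    (hlen.trans_lt hlt) (ℓ := b - a)
    (hxc.comp (by fun_prop) fun s hs => ⟨by linarith [hs.1], by linarith [hs.2]⟩)
    (fun s hs => by
      have hs' : a + s ∈ Set.Ico a b := ⟨by linarith [hs.1], by linarith [hs.2]⟩
      have h1 := hxd (a + s) hs'
      have h2 := (hcons (a + s) ⟨hs'.1, hs'.2.le⟩).1
      rw [hxa, hea, add_zero] at h2
      have h3 : HState.e (ξ (a + s) (j + 1)) = x₀ - HState.x (ξ (a + s) (j + 1)) := by
        rw [← h2]; abel
      rw [h3] at h1
      have h4 := h1.scomp s (((hasDerivAt_id s).const_add a).hasDerivWithinAt (s := Set.Ici s))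
        (fun u (hu : s ≤ u) => show a + s ≤ a + u by linarith)
      simp only [one_smul] at h4
      simp only [add_zero, hxa]
      exact h4)
    (by simpa only [add_zero, hxa] using hVc)
    (fun s hs => by
      simpa only [add_zero, hxa] using hsafe s ⟨hs.1, hs.2.trans hlen⟩)
    (b - a) ⟨by linarith, le_rfl⟩
  simp only [add_sub_cancel, add_zero, hxa] at hflow
  obtain ⟨h1, h2, h3, h4⟩ := hcons b ⟨hab, le_rfl⟩
  refine ⟨hlen.trans hmax, hflow.trans ?_, ?_, by rw [h1, hxa, hea, add_zero], by rw [h2, hηa],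
    fun hb => ?_⟩
  · refine mul_le_mul_of_nonneg_right (Real.exp_le_exp.2 ?_) hv0
    have h5 : |ε i| ≤ ∑ i, |ε i| :=
      Finset.single_le_sum (f := fun i => |ε i|) (fun i _ => abs_nonneg _) (Finset.mem_univ i)
    have h6 := neg_abs_le (ε i)
    have h7 := abs_nonneg (ε i)
    calc -ε i * (b - a) ≤ |ε i| * (b - a) := by nlinarith
      _ ≤ (∑ i, |ε i|) * maxInterval δ ε γ L := by
        have := hlen.trans hmax
        have := sub_nonneg.2 hab
        gcongr
  · rcases hab.eq_or_lt with hab' | hab'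
    · rw [← hab', hxa]; exact hVc
    · exact hflow.trans (hsafe (b - a) ⟨by linarith, hlen⟩).le
  · have hD : HState.τ (ξ b (j + 1)) = HState.h (ξ b (j + 1)) :=
      (hξ.jump b (j + 1) (hmem b ⟨hab, le_rfl⟩) hb).1
    have hbh : b - a = h := by linarith
    rw [hbh] at hflow
    refine hflow.trans (hend.trans ?_)
    refine mul_le_mul_of_nonneg_right (Real.exp_le_exp.2 ?_) (hv0.trans (le_max_left _ _))
    have := lt_min hA.εref_pos hA.ε_pos
    nlinarith

/-- Geometric decay of `V` and of the window entries at the sampling instants `t (j + 1)`, just before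
the jump. -/
theorem sample_bounds (hA : StandingAssumptions f 𝒳 ℰ V c δ εref m ε γ L) {dom : Set (ℝ × ℕ)}
    {ξ : ℝ → ℕ → HState np nc (m - 1)} (hξ : (loop f V c δ εref m ε γ L).IsSolution dom ξ)
    (h0 : V (HState.x (ξ 0 0)) ≤ c) {A lam : ℝ} (hlam0 : 0 < lam) (hlam1 : lam < 1)
    (hlam : lam ^ m = sampleDecay δ εref ε γ L)
    (hAV : V (HState.x (ξ 0 0)) ≤ A * lam ^ (m - 1))
    (hAη : ∀ i, |HState.η (ξ 0 0) i| ≤ A * lam ^ (m - 1))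
    {J : ℕ} {t : ℕ → ℝ} (ht1 : t 1 = 0) (htm : ∀ j ≤ J, t j ≤ t (j + 1))
    (hdom : ∀ j ≤ J, ∀ s ∈ Set.Icc (t j) (t (j + 1)), (s, j) ∈ dom) :
    ∀ j < J, t (j + 1) ≤ j * maxInterval δ ε γ L ∧ V (HState.x (ξ (t (j + 1)) j)) ≤ c ∧
      V (HState.x (ξ (t (j + 1)) j)) ≤ A * lam ^ (j + (m - 1)) ∧
      ∀ i, |HState.η (ξ (t (j + 1)) j) i| ≤ A * lam ^ (j + i.val) := by
  have hA0 : 0 ≤ A := by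
    have h1 := (hA.V_nonneg h0).trans hAV
    exact nonneg_of_mul_nonneg_left h1 (by positivity)
  have hanti : ∀ {p q : ℕ}, p ≤ q → A * lam ^ q ≤ A * lam ^ p := fun hpq =>
    mul_le_mul_of_nonneg_left (pow_le_pow_of_le_one hlam0.le hlam1.le hpq) hA0
  intro j
  induction j with
  | zero =>
    intro _
    rw [zero_add, ht1]
    refine ⟨by simp, h0, by simpa using hAV, fun i => (hAη i).trans (hanti (by omega))⟩
  | succ j ih =>
    intro hj
    obtain ⟨ht, hVc, hV, hη⟩ := ih (by omega)
    have h1 := htm (j + 1) hj.le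
    obtain ⟨h2, -, h3, -, h4, h5⟩ := hA.phase_estimate hξ h1
      (hdom j (by omega) _ ⟨htm j (by omega), le_rfl⟩) (hdom (j + 1) hj.le) hVc
    have h6 := h5 (hdom (j + 2) hj _ ⟨le_rfl, htm (j + 2) hj⟩)
    refine ⟨?_, h3, h6.trans ?_, fun i => ?_⟩
    · push_cast; linarith
    · have h7 : max (V (HState.x (ξ (t (j + 1)) j)))
          (windowBound V c m (HState.x (ξ (t (j + 1)) j)) (HState.η (ξ (t (j + 1)) j))) ≤
          A * lam ^ j :=
        max_le (hV.trans (hanti (by omega)))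
          (windowBound_le hA.one_le_m (hV.trans (hanti (by omega)))
            fun i => (hη i).trans (hanti (by omega)))
      have h8 : A * lam ^ (j + 1 + (m - 1)) = lam ^ m * (A * lam ^ j) := by
        have := hA.one_le_m
        rw [show j + 1 + (m - 1) = m + j by omega, pow_add]; ring
      rw [h8, hlam]
      exact mul_le_mul_of_nonneg_left h7 (Real.exp_pos _).le
    · rw [h4]
      exact abs_windowUpdate_le (hA.V_nonneg hVc) hV hη i

theorem isAsymptoticallyStable (hA : StandingAssumptions f 𝒳 ℰ V c δ εref m ε γ L) :
    IsAsymptoticallyStable (loop f V c δ εref m ε γ L) {x | V x ≤ c} := by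
  obtain ⟨-, -, -, -, -, -, -, -, αV, αV', -, -, -, -, -, -, hαV, hαV', -, hVb, -, -⟩ :=
    hA.lyapunov 0
  obtain ⟨ψ, hψ, hψinv⟩ := hαV.exists_inverse
  have hfb := hA.fallback_pos
  have hm0 : (0 : ℝ) < m := by exact_mod_cast hA.one_le_m
  have hδ := hA.δ_pos
  have hTsum : 0 ≤ ∑ i, δ * Tmax (γ i) (max (L i + ε i / 2) (1 - δ)) :=
    Finset.sum_nonneg fun i _ => (mul_pos hδ (Tmax_pos (hA.lyapunov i).2.1
      (lt_max_of_lt_right (by linarith [hA.δ_lt_one])))).le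
  have hmax : 0 < maxInterval δ ε γ L := by unfold maxInterval; linarith
  set M := maxInterval δ ε γ L with hM
  have hgrow : 1 ≤ growth δ ε γ L := by
    unfold growth
    rw [Real.one_le_exp_iff]
    exact mul_nonneg (Finset.sum_nonneg fun i _ => abs_nonneg _) hmax.le
  set κ : ℝ := min εref (ε 0) * fallback δ (ε 0) (γ 0) (L 0) / m with hκ
  have hκ0 : 0 < κ := by
    have := lt_min hA.εref_pos hA.ε_pos
    positivity
  -- the decay factor per sample; a whole window of `m` samples gains the factor `sampleDecay`
  obtain ⟨lam, hlamdef⟩ : ∃ l : ℝ≥0, l = expDecay κ 1 := ⟨_, rfl⟩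
  have hlamexp : (lam : ℝ) = Real.exp (-κ) := by rw [hlamdef, coe_expDecay]; simp
  have hlam0 : 0 < lam := hlamdef ▸ expDecay_pos _ _
  have hlam1 : (lam : ℝ) < 1 := by rw [hlamexp, Real.exp_lt_one_iff]; linarith
  have hlam : (lam : ℝ) ^ m = sampleDecay δ εref ε γ L := by
    rw [hlamexp, ← Real.exp_nat_mul, sampleDecay, hκ]
    congr 1; field_simp
  have hBK : ClassK fun q => (αV' q + q) * ((lam ^ (m - 1))⁻¹ * lam⁻¹) :=
    (hαV'.toClassK.add classK_id).mul_const (by positivity)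
  set g : ℝ≥0 := Real.toNNReal (growth δ ε γ L) with hg
  have hgc : (g : ℝ) = growth δ ε γ L := Real.coe_toNNReal _ (by linarith)
  have hg1 : 1 ≤ g := by rw [← NNReal.coe_le_coe, hgc]; exact hgrow
  have hΨK : ClassK fun s => ψ (s * g) * 3 + s * m :=
    ((hψ.comp (classK_id.mul_const (by positivity))).mul_const (by norm_num)).add
      (classK_id.mul_const (by exact_mod_cast hm0))
  refine ⟨_, classKLL_expDecay hΨK hBK (a := κ / (2 * M)) (b := κ / 2) (by positivity)
    (by positivity), ?_⟩
  intro dom ξ hξ hinit hx0 T J hTJ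
  have hx0 : V (HState.x (ξ 0 0)) ≤ c := hx0
  obtain ⟨t, ht0, htT, htm, hdom⟩ := hξ.domain.exists_phases hTJ
  -- no flow is possible before the first sample
  have ht1 : t 1 = 0 := by
    by_contra hne
    have hlt : t 0 < t 1 := lt_of_le_of_ne (htm 0 (Nat.zero_le _)) (by rw [ht0]; exact Ne.symm hne)
    have := hybridLoop_elapsed_le hA.continuous_f hξ hlt (hdom 0 (Nat.zero_le _))
    rw [ht0] at this hlt
    have := hinit.2
    linarith
  set q := stackedNorm (ξ 0 0) with hq
  have hpow1 : lam ^ (m - 1) ≤ 1 := pow_le_one₀ (by positivity) (by exact_mod_cast hlam1.le)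
  have hm1 : (1 : ℝ≥0) ≤ m := by exact_mod_cast hA.one_le_m
  cases J with
  | zero =>
    have hT0 : T = 0 := by rw [← htT, ht1]
    subst hT0
    have hq1 : q ≤ (αV' q + q) * ((lam ^ (m - 1))⁻¹ * lam⁻¹) := by
      have h1 : 1 ≤ (lam ^ (m - 1))⁻¹ * lam⁻¹ :=
        one_le_mul (one_le_inv₀ (by positivity) |>.2 hpow1)
          (one_le_inv₀ hlam0 |>.2 (by exact_mod_cast hlam1.le))
      calc q ≤ αV' q + q := le_add_self
        _ ≤ _ := le_mul_of_one_le_right (by positivity) h1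
    have he : ∀ a : ℝ, expDecay a 0 = 1 := fun a => by simp [expDecay]
    simp only [Real.toNNReal_zero, Nat.cast_zero, he, mul_one]
    calc q ≤ _ := hq1
      _ ≤ (αV' q + q) * ((lam ^ (m - 1))⁻¹ * lam⁻¹) * m :=
        le_mul_of_one_le_right (by positivity) hm1
      _ ≤ _ := le_add_self
  | succ j =>
    set A : ℝ≥0 := (αV' q + q) * (lam ^ (m - 1))⁻¹ with hAdef
    have hAmul : (A : ℝ) * (lam : ℝ) ^ (m - 1) = αV' q + q := by
      have h1 : A * lam ^ (m - 1) = αV' q + q := by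
        rw [hAdef, inv_mul_cancel_right₀ (by positivity)]
      exact_mod_cast congrArg NNReal.toReal h1
    have hxq : (αV' ‖HState.x (ξ 0 0)‖₊ : ℝ) ≤ αV' q := by
      exact_mod_cast hαV'.strictMono.monotone (nnnorm_x_le_stackedNorm _)
    have hηq : ‖HState.η (ξ 0 0)‖ ≤ q := by exact_mod_cast nnnorm_η_le_stackedNorm (ξ 0 0)
    obtain ⟨htj, hVc, hV, hη⟩ := hA.sample_bounds hξ hx0 (A := A) (lam := lam)
      (by exact_mod_cast hlam0) hlam1 hlam
      (by rw [hAmul]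
          have := (hVb _ (hA.sublevel_subset hx0)).2
          have := q.coe_nonneg
          linarith)
      (fun i => by
        rw [hAmul]
        have h1 := PiLp.norm_apply_le (HState.η (ξ 0 0)) i
        rw [Real.norm_eq_abs] at h1
        have := (αV' q).coe_nonneg
        linarith) ht1 htm hdom j (Nat.lt_succ_self j)
    have h1 := htm (j + 1) le_rfl
    obtain ⟨h2, h3, h4, h5, h6, -⟩ := hA.phase_estimate hξ h1
      (hdom j (by omega) _ ⟨htm j (by omega), le_rfl⟩) (hdom (j + 1) le_rfl) hVc
    rw [htT] at h2 h3 h4 h5 h6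
    set x₀ := HState.x (ξ (t (j + 1)) j) with hx₀
    have hlamle : ∀ k : ℕ, (lam : ℝ) ^ (j + k) ≤ (lam : ℝ) ^ j := fun k =>
      pow_le_pow_of_le_one lam.coe_nonneg hlam1.le (by omega)
    have hA0 : (0 : ℝ) ≤ A := A.coe_nonneg
    have hV' : V x₀ ≤ A * (lam : ℝ) ^ j := hV.trans (mul_le_mul_of_nonneg_left (hlamle _) hA0)
    -- the bounds in terms of the sample number
    set s : ℝ≥0 := A * lam ^ j with hs
    have hsc : (s : ℝ) = A * (lam : ℝ) ^ j := by simp [hs]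
    have hxb : ‖HState.x (ξ T (j + 1))‖₊ ≤ ψ (s * g) := by
      refine hψinv _ _ ?_
      rw [← NNReal.coe_le_coe, NNReal.coe_mul, hgc, hsc]
      refine ((hVb _ (hA.sublevel_subset h4)).1.trans h3).trans ?_
      rw [mul_comm]
      gcongr
    have hx₀b : ‖x₀‖₊ ≤ ψ (s * g) := by
      refine (hψinv _ s ?_).trans
        (hψ.strictMono.monotone (le_mul_of_one_le_right (by positivity) hg1))
      rw [← NNReal.coe_le_coe, hsc]
      exact (hVb _ (hA.sublevel_subset hVc)).1.trans hV'
    have heb : ‖HState.e (ξ T (j + 1))‖₊ ≤ ψ (s * g) + ψ (s * g) := by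
      have : HState.e (ξ T (j + 1)) = x₀ - HState.x (ξ T (j + 1)) := by rw [← h5]; abel
      rw [this]
      exact (nnnorm_sub_le _ _).trans (add_le_add hx₀b hxb)
    have hηb : ‖HState.η (ξ T (j + 1))‖₊ ≤ s * m := by
      rw [← NNReal.coe_le_coe, NNReal.coe_mul, hsc, NNReal.coe_natCast, coe_nnnorm, h6]
      have h7 := norm_le_mul_of_abs_le (B := A * (lam : ℝ) ^ j) fun i =>
        (abs_windowUpdate_le (hA.V_nonneg hVc) hV hη i).trans
          (mul_le_mul_of_nonneg_left (by rw [add_assoc]; exact hlamle _) hA0)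
      refine h7.trans ?_
      rw [mul_comm]
      gcongr
      exact Nat.sub_le _ _
    have hstack : stackedNorm (ξ T (j + 1)) ≤ ψ (s * g) * 3 + s * m := by
      refine (stackedNorm_le _).trans ((add_le_add_three hxb heb hηb).trans (le_of_eq ?_))
      ring
    refine hstack.trans (hΨK.strictMono.monotone ?_)
    -- elapsed time and number of samples both control the exponent
    have hT0 : 0 ≤ T := hξ.domain.nonneg _ hTJ
    have hTle : T ≤ (j + 1) * M := by linarith
    have hexp := expDecay_one_pow_le hκ0 hmax hT0 hTle
    rw [← hlamdef] at hexp
    calc s ≤ A * (lam⁻¹ * (expDecay (κ / (2 * M)) T.toNNReal *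
        expDecay (κ / 2) ((j + 1 : ℕ) : ℝ≥0))) := by rw [hs]; gcongr
      _ = _ := by rw [hAdef]; ring

end StandingAssumptions

end Stability

end DynSTC

theorem theorem1 {np nc nu : ℕ}
    (fp : EuclideanSpace ℝ (Fin np) → EuclideanSpace ℝ (Fin nu) → EuclideanSpace ℝ (Fin np))
    (fc : EuclideanSpace ℝ (Fin nc) → EuclideanSpace ℝ (Fin np) → EuclideanSpace ℝ (Fin nc))
    (gc : EuclideanSpace ℝ (Fin nc) → EuclideanSpace ℝ (Fin np) → EuclideanSpace ℝ (Fin nu))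
    -- the closed-loop vector field is continuous
    (hf : Continuous (fun p : DynSTC.XSpace np nc × DynSTC.XSpace np nc =>
      DynSTC.closedLoop fp fc gc p.1 p.2))
    (V : DynSTC.XSpace np nc → ℝ) (hV : Continuous V)
    (c : ℝ) (hc : 0 < c)
    (𝒳 ℰ : Set (DynSTC.XSpace np nc))
    -- the level set is contained in `𝒳`, its difference set in `ℰ`
    (h𝒳 : {x | V x ≤ c} ⊆ 𝒳)
    (hℰ : {e | ∃ y ∈ {x | V x ≤ c}, ∃ x ∈ {x | V x ≤ c}, e = y - x} ⊆ ℰ)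
    -- points at level `c` are interior to `𝒳` or limits of points of lower level
    (hbd : ∀ x, V x = c → x ∈ interior 𝒳 ∪ closure {y | V y < c})
    (n : ℕ) (ε γ L : Fin (n + 1) → ℝ)
    (hLyap : ∀ i, DynSTC.HybridLyapunov (DynSTC.closedLoop fp fc gc) 𝒳 ℰ V (ε i) (γ i) (L i))
    (hε : 0 < ε 0)
    (m : ℕ) (hm : 1 ≤ m)
    (δ : ℝ) (hδ0 : 0 < δ) (hδ1 : δ < 1)
    (εref : ℝ) (hεref : 0 < εref) :
    0 < DynSTC.fallback δ (ε 0) (γ 0) (L 0) ∧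
    DynSTC.InterSamplingAtLeast
      (DynSTC.hybridLoop (DynSTC.closedLoop fp fc gc) (DynSTC.windowUpdate V m)
        (DynSTC.algorithmΓ V c m δ εref ε γ L))
      (DynSTC.fallback δ (ε 0) (γ 0) (L 0)) ∧
    DynSTC.IsAsymptoticallyStable
      (DynSTC.hybridLoop (DynSTC.closedLoop fp fc gc) (DynSTC.windowUpdate V m)
        (DynSTC.algorithmΓ V c m δ εref ε γ L))
      {x | V x ≤ c} := by
  have h0 : ∀ x, V x ≤ c → (0 : DynSTC.XSpace np nc) ∈ ℰ := fun x hx =>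
    hℰ ⟨x, hx, x, hx, (sub_self x).symm⟩
  have hA : DynSTC.StandingAssumptions (DynSTC.closedLoop fp fc gc) 𝒳 ℰ V c δ εref m ε γ L :=
    { continuous_f := hf
      continuous_V := hV
      c_pos := hc
      sublevel_subset := h𝒳
      sub_mem := fun y x hy hx => hℰ ⟨y, hy, x, hx, rfl⟩
      mem_closure := fun x hx => (hbd x hx).elim
        (fun hint => hx ▸ (hLyap 0).mem_closure_lt hf hε hV (h0 x hx.le) hint (hx.symm ▸ hc)) id
      lyapunov := hLyap
      ε_pos := hε
      one_le_m := hm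
      δ_pos := hδ0
      δ_lt_one := hδ1
      εref_pos := hεref }
  exact ⟨hA.fallback_pos,
    DynSTC.interSamplingAtLeast_of_le hf fun x η => DynSTC.fallback_le_algorithmΓ x η,
    hA.isAsymptoticallyStable⟩
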